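/- **Theorem.** Let $T$ be a locally finite tree with root $\rho$ in which all vertices at the same distance from $\rho$ have the same number of children. Let $p_1,p_2,\dots$ satisfy $0<\inf_n p_n\le\sup_n p_n<1$. Consider stationary dynamical percolation $(\omega_t)_{t\in\mathbb R}$ on $T$: the edges evolve independently, and each edge between levels $n-1$ and $n$ follows a stationary two-state continuous-time Markov chain which switches from closed to open at rate $p_n$ and from open to closed at rate $1-p_n$ (so that it is open with probability $p_n$ at each fixed time). By convention, an edge is open at the times at which it changes state, so that the set of times at which an edge is open is closed. Let $\mathcal Q$ be the (random) set of times $t\in\mathbb R$ at which the connected component of $\rho$ in the graph of open edges of $\omega_t$ is infinite, and let $\partial\mathcal Q$ be its topological boundary in $\mathbb R$. If $\mathbf P(0\in\partial\mathcal Q)>0$, then almost surely $\mathcal Q=\partial\mathcal Q$; moreover, almost surely the set of times $t\in\mathbb R$ at which $\omega_t$ has no infinite connected component (anywhere in $T$) is dense in $\mathbb R$. -/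

import Mathlib

open MeasureTheory ProbabilityTheory

namespace DynPerc

/-! ### The two-state chain of a single edge

The state `true` means open, the state `false` means closed. -/

/-- The generator of the two-state continuous time Markov chain in which closed switches to open at
rate `p` and open switches to closed at rate `1 - p`. -/
def generator (p : ℝ) : Matrix Bool Bool ℝ
  | false, false => -p
  | false, true => p
  | true, false => 1 - p
  | true, true => -(1 - p)

/-- The transition matrix over a time span `t`: the matrix exponential of `t` times the generator. -/
noncomputable def transition (p t : ℝ) : Matrix Bool Bool ℝ :=
  NormedSpace.exp (t • generator p)

/-- The stationary distribution of the chain: open with probability `p`. -/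
def stationaryLaw (p : ℝ) : Bool → ℝ
  | true => p
  | false => 1 - p

/-- The transition matrix in closed form: with probability `exp (-t)` nothing happens, otherwise the
state is refreshed from the stationary law. -/
theorem transition_apply (p t : ℝ) (a b : Bool) :
    transition p t a b =
      Real.exp (-t) * (if a = b then 1 else 0) + (1 - Real.exp (-t)) * stationaryLaw p b := by
  let : NormedRing (Matrix Bool Bool ℝ) := Matrix.linftyOpNormedRing
  let : NormedAlgebra ℝ (Matrix Bool Bool ℝ) := Matrix.linftyOpNormedAlgebra
  let : NormedAlgebra ℚ (Matrix Bool Bool ℝ) := NormedAlgebra.restrictScalars ℚ ℝ _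
  have hsq : generator p * generator p = -generator p := by
    ext a b
    cases a <;> cases b <;> simp [Matrix.mul_apply, generator] <;> ring
  have hpow : ∀ n : ℕ, generator p ^ (n + 1) = (-1 : ℝ) ^ n • generator p := by
    intro n
    induction n with
    | zero => simp
    | succ n ih => rw [pow_succ, ih, smul_mul_assoc, hsq, pow_succ]; simp
  have hE : HasSum (fun n : ℕ => (n.factorial : ℝ)⁻¹ • (-t) ^ n) (Real.exp (-t)) := by
    rw [Real.exp_eq_exp_ℝ]
    exact NormedSpace.exp_series_hasSum_exp' (𝕂 := ℝ) (-t)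
  have hM := NormedSpace.exp_series_hasSum_exp' (𝕂 := ℝ) (t • generator p)
  have hF : HasSum (fun n : ℕ => (n.factorial : ℝ)⁻¹ • (t • generator p) ^ n)
      (Real.exp (-t) • (-generator p) + (1 + generator p)) := by
    have h1 := hE.smul_const (-generator p)
    have h2 : HasSum (fun n : ℕ => if n = 0 then (1 + generator p) else 0) (1 + generator p) :=
      hasSum_ite_eq 0 _
    convert h1.add h2 using 1
    funext n
    cases n with
    | zero => simp
    | succ n =>
      rw [smul_pow, hpow n, neg_pow t (n + 1), if_neg (Nat.succ_ne_zero n)]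
      simp only [smul_smul, smul_neg, ← neg_smul, add_zero, smul_eq_mul]
      congr 1
      ring
  have hk : transition p t = Real.exp (-t) • (-generator p) + (1 + generator p) :=
    hM.unique hF
  rw [hk]
  cases a <;> cases b <;> simp [generator, stationaryLaw] <;> ring

/-! ### Dynamical percolation on a graph -/

variable {V Ω : Type*}

/-- `ω` is (stationary) dynamical percolation, indexed by all times `t : ℝ`, on the graph `G` with
edge probabilities `p`: the edges evolve independently, and each edge `e` follows the stationary
two-state continuous time Markov chain with rates `p e` (closed to open) and `1 - p e` (open to
closed).  The last field says that each edge almost surely changes state only finitely often in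
bounded time, and that it is open at the times at which it changes state: the set of its open times
is closed, without isolated points (it is the closure of its interior), and has only finitely many
boundary points in each bounded interval. -/
structure IsDynamicalPercolation [MeasurableSpace Ω] (μ : Measure Ω) (G : SimpleGraph V)
    (p : G.edgeSet → ℝ) (ω : ℝ → G.edgeSet → Ω → Bool) : Prop where
  measurable : ∀ t e, Measurable (ω t e)
  indep : iIndepFun (fun (e : G.edgeSet) (x : Ω) (t : ℝ) => ω t e x) μ
  markov : ∀ (e : G.edgeSet) (n : ℕ) (t : Fin (n + 1) → ℝ), StrictMono t →
    ∀ s : Fin (n + 1) → Bool,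
      μ {x | ∀ i, ω (t i) e x = s i} =
        ENNReal.ofReal (stationaryLaw (p e) (s 0) *
          ∏ i : Fin n, transition (p e) (t i.succ - t i.castSucc) (s i.castSucc) (s i.succ))
  paths : ∀ᵐ x ∂μ, ∀ e : G.edgeSet,
    closure (interior {t | ω t e x = true}) = {t | ω t e x = true} ∧
      ∀ a b : ℝ, (frontier {t | ω t e x = true} ∩ Set.Icc a b).Finite

/-- The subgraph of `G` formed by the open edges of a configuration. -/
def openSubgraph (G : SimpleGraph V) (η : G.edgeSet → Bool) : SimpleGraph V where
  Adj u v := ∃ h : G.Adj u v, η ⟨s(u, v), h⟩ = true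
  symm := ⟨by
    rintro u v ⟨h, hη⟩
    refine ⟨h.symm, ?_⟩
    have he : (⟨s(v, u), h.symm⟩ : G.edgeSet) = ⟨s(u, v), h⟩ := Subtype.ext Sym2.eq_swap
    rw [he]
    exact hη⟩
  loopless := ⟨fun v h => G.loopless.irrefl v h.1⟩

/-- The cluster of a vertex: all vertices connected to it by a path of open edges. -/
def cluster (G : SimpleGraph V) (η : G.edgeSet → Bool) (v : V) : Set V :=
  {w | (openSubgraph G η).Reachable v w}

/-- The set of times at which the cluster of `v` is infinite, for the sample point `x`. -/
def percolationTimes (G : SimpleGraph V) (ω : ℝ → G.edgeSet → Ω → Bool) (v : V) (x : Ω) : Set ℝ :=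
  {t | (cluster G (fun e => ω t e x) v).Infinite}

/-! ### Spherically symmetric trees -/

/-- The children of `v` in a tree `T` with root `ρ`. -/
def children (T : SimpleGraph V) (ρ v : V) : Set V :=
  {w | T.Adj v w ∧ T.dist ρ w = T.dist ρ v + 1}

/-- `T` is a locally finite tree which is spherically symmetric about the root `ρ`: all vertices on
a given level have the same number of children. -/
structure IsSphericallySymmetricTree (T : SimpleGraph V) (ρ : V) : Prop where
  isTree : T.IsTree
  locallyFinite : ∀ v, (T.neighborSet v).Finite
  symmetric : ∀ u v, T.dist ρ u = T.dist ρ v → (children T ρ u).ncard = (children T ρ v).ncard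

/-- The level of an edge: the distance from the root `ρ` to its farther endpoint, so that edges
from level `n - 1` to level `n` have level `n`. -/
noncomputable def edgeLevel (T : SimpleGraph V) (ρ : V) (e : T.edgeSet) : ℕ :=
  (Sym2.map (T.dist ρ) e.1).sup

theorem edgeLevel_mk (T : SimpleGraph V) (ρ u v : V) (h : T.Adj u v) :
    edgeLevel T ρ ⟨s(u, v), h⟩ = max (T.dist ρ u) (T.dist ρ v) := by
  simp [edgeLevel]

end DynPerc

/-!
# Exceptional times of non-percolation on spherically symmetric trees

For a vertex `v` let `Q v` be the random set of times at which `v` is connected to infinity through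
its descendants; it is closed, because the edges are open during closed sets of times. By
stationarity it suffices to show that, if `0` lies in `Q ρ` but not in its interior with positive
probability, then almost surely `0` is not interior to `Q v`, for any `v`. The density of the times
without any infinite cluster then follows from Baire's theorem, because every infinite cluster has
a vertex nearest to the root, and goes down from it.

Let `s n` be the probability that `0 ∈ Q v`, and `q n` the probability that `0` is interior to
`Q v`, for `v` on level `n`. The sequence `s` satisfies
`s n = 1 - (1 - p (n + 1) * s (n + 1)) ^ d n`, where `d n` is the number of children of a
vertex on level `n`. The first main point is that `q` solves the same recursion. This
amounts to the fact that, if `0` is interior to a finite union of independent stationary closed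
random sets, then almost surely it is interior to one of them (`ae_intAt_or`).

The second main point is that a solution `q > 0` must be equal to `s`. For a positive solution `x`,
the quantity `1 / (w n * x n)`, where `w n` is the mean number of vertices on level `n` connected
to the root at time `0`, decreases in `n` by an amount which is larger for larger `x`
(`correction_mono`). Hence `q ≤ s` are equal as soon as `w n * q n` is unbounded
(`recursion_unique`). This mean is the expected number of vertices `v` on level `n` which are
connected to the root and have `0` interior to `Q v`. If it were bounded, then the first `n` levels
would leave the event that `0` is interior to `Q ρ` undecided with a probability not tending to `0`
(`IsBranchingEvent.mean_unbounded`). Therefore `q 0 < s 0` forces `q = 0`.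

All events are expressed through rational times, so that they are measurable. That `0` is interior
to a set `A` of times becomes `IntAt A 0`, which for closed sets has the same meaning.
-/

namespace DynPerc

/-! ### Uniqueness of positive solutions of the survival recursion -/

theorem natCast_sq_mul_pow_le_geom_sum_sq {z : ℝ} (hz : 0 < z) (d : ℕ) :
    (d : ℝ) ^ 2 * z ^ (d - 1) ≤ (∑ i ∈ Finset.range d, z ^ i) ^ 2 := by
  -- Reversing the sum, the right side is `∑ z ^ i * ∑ z ^ (d - 1 - i)`.
  have h := Finset.sum_sq_le_sum_mul_sum_of_sq_le_mul (Finset.range d)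
    (r := fun _ => Real.sqrt (z ^ (d - 1)))
    (f := fun i => z ^ i) (g := fun i => z ^ (d - 1 - i))
    (fun i _ => by positivity) (fun i _ => by positivity) (fun i hi => by
      rw [Real.sq_sqrt (by positivity), ← pow_add]
      refine le_of_eq (congrArg _ ?_)
      have := Finset.mem_range.1 hi
      omega)
  rw [Finset.sum_range_reflect (fun i => z ^ i) d] at h
  simp only [Finset.sum_const, Finset.card_range, nsmul_eq_mul] at h
  rw [mul_pow, Real.sq_sqrt (by positivity)] at h
  rw [sq (∑ i ∈ Finset.range d, z ^ i)]
  exact h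

/-- The correction `1 / f y - 1 / (d y)` to linearity, where `f y = 1 - (1 - y) ^ d` is the
probability that one of `d` independent events of probability `y` occurs. -/
noncomputable def correction (d : ℕ) (y : ℝ) : ℝ := (1 - (1 - y) ^ d)⁻¹ - (d * y)⁻¹

theorem one_sub_pow_pos {d : ℕ} (hd : d ≠ 0) {y : ℝ} (hy : 0 < y) (hy1 : y ≤ 1) :
    0 < 1 - (1 - y) ^ d := by
  have := pow_lt_one₀ (by linarith : 0 ≤ 1 - y) (by linarith) hd
  linarith

theorem correction_mono {d : ℕ} (hd : d ≠ 0) {y z : ℝ} (hy : 0 < y) (hyz : y ≤ z) (hz : z < 1) :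
    correction d y ≤ correction d z := by
  have hd' : (0 : ℝ) < d := by positivity
  have hder : ∀ x ∈ Set.Ioo (0 : ℝ) 1, HasDerivAt (correction d)
      (-(d * (1 - x) ^ (d - 1)) / (1 - (1 - x) ^ d) ^ 2 + (d : ℝ) / (d * x) ^ 2) x := by
    intro x hx
    have h1 : HasDerivAt (fun x : ℝ => 1 - (1 - x) ^ d) (d * (1 - x) ^ (d - 1)) x := by
      have := (((hasDerivAt_id x).const_sub 1).pow d).const_sub 1
      simpa using this
    have h2 : HasDerivAt (fun x : ℝ => (d : ℝ) * x) d x := by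
      simpa using (hasDerivAt_id x).const_mul (d : ℝ)
    have h3 := (h1.inv (one_sub_pow_pos hd hx.1 hx.2.le).ne').sub
      (h2.inv (mul_pos hd' hx.1).ne')
    refine h3.congr_deriv ?_
    ring
  have hmono : MonotoneOn (correction d) (Set.Ioo 0 1) := by
    refine monotoneOn_of_deriv_nonneg (convex_Ioo 0 1)
      (fun x hx => (hder x hx).continuousAt.continuousWithinAt)
      (fun x hx => ?_) (fun x hx => ?_)
    · rw [interior_Ioo] at hx
      exact (hder x hx).differentiableAt.differentiableWithinAt
    · rw [interior_Ioo] at hx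
      rw [(hder x hx).deriv]
      have hx0 := hx.1
      have hf := one_sub_pow_pos hd hx.1 hx.2.le
      have hgeom : 1 - (1 - x) ^ d = x * ∑ i ∈ Finset.range d, (1 - x) ^ i := by
        have := geom_sum_mul (1 - x) d
        linarith
      have hkey := natCast_sq_mul_pow_le_geom_sum_sq (sub_pos.2 hx.2) d
      have : (d : ℝ) * (1 - x) ^ (d - 1) / (1 - (1 - x) ^ d) ^ 2 ≤ d / (d * x) ^ 2 := by
        rw [div_le_div_iff₀ (by positivity) (by positivity), hgeom]
        nlinarith [mul_le_mul_of_nonneg_left hkey (by positivity : 0 ≤ (d : ℝ) * x ^ 2)]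
      rw [neg_div]
      linarith
  exact hmono ⟨hy, hyz.trans_lt hz⟩ ⟨hy.trans_le hyz, hz⟩ hyz

/-- Two positive solutions `q ≤ s` of the recursion `x n = 1 - (1 - p (n + 1) * x (n + 1)) ^ d n`
of survival probabilities agree at `0` as soon as the smaller one, multiplied by the mean number of
particles, is unbounded. The quantities `1 / (mean * x n)` decrease by `correction / mean`, and the
correction is larger for `s` than for `q`. -/
theorem recursion_unique {d : ℕ → ℕ} {p q s : ℕ → ℝ} (hd : ∀ n, d n ≠ 0)
    (hp : ∀ n, 0 < p (n + 1) ∧ p (n + 1) < 1) (hq : ∀ n, 0 < q n) (hqs : ∀ n, q n ≤ s n)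
    (hs : ∀ n, s n ≤ 1)
    (hqrec : ∀ n, q n = 1 - (1 - p (n + 1) * q (n + 1)) ^ d n)
    (hsrec : ∀ n, s n = 1 - (1 - p (n + 1) * s (n + 1)) ^ d n)
    (hunb : ∀ C : ℝ, ∃ n, C < (∏ i ∈ Finset.range n, d i * p (i + 1)) * q n) :
    q 0 = s 0 := by
  set w : ℕ → ℝ := fun n => ∏ i ∈ Finset.range n, d i * p (i + 1) with hw
  have hd' : ∀ n, (0 : ℝ) < d n := fun n => Nat.cast_pos.2 (Nat.pos_of_ne_zero (hd n))
  have hwpos : ∀ n, 0 < w n := fun n => Finset.prod_pos fun i _ => mul_pos (hd' i) (hp i).1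
  have hspos : ∀ n, 0 < s n := fun n => (hq n).trans_le (hqs n)
  have step : ∀ x : ℕ → ℝ, (∀ n, 0 < x n) →
      (∀ n, x n = 1 - (1 - p (n + 1) * x (n + 1)) ^ d n) → ∀ n,
      (w n * x n)⁻¹ = (w (n + 1) * x (n + 1))⁻¹ +
        correction (d n) (p (n + 1) * x (n + 1)) * (w n)⁻¹ := by
    intro x hx hrec n
    have h1 : w (n + 1) = w n * (d n * p (n + 1)) := Finset.prod_range_succ _ _
    rw [correction, ← hrec n, h1, mul_inv, mul_inv, mul_inv, mul_inv, mul_inv, mul_inv]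
    ring
  have hdiff : ∀ n, (w 0 * q 0)⁻¹ - (w n * q n)⁻¹ ≤ (w 0 * s 0)⁻¹ - (w n * s n)⁻¹ := by
    intro n
    induction n with
    | zero => simp
    | succ n ih =>
      have h1 := step q hq hqrec n
      have h2 := step s hspos hsrec n
      have h3 : correction (d n) (p (n + 1) * q (n + 1)) ≤
          correction (d n) (p (n + 1) * s (n + 1)) := by
        refine correction_mono (hd n) (mul_pos (hp n).1 (hq _))
          (mul_le_mul_of_nonneg_left (hqs _) (hp n).1.le) ?_
        calc p (n + 1) * s (n + 1) ≤ p (n + 1) * 1 :=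
              mul_le_mul_of_nonneg_left (hs _) (hp n).1.le
          _ < 1 := by simpa using (hp n).2
      have h4 := mul_le_mul_of_nonneg_right h3 (inv_nonneg.2 (hwpos n).le)
      linarith
  have hw0 : w 0 = 1 := by simp [hw]
  refine le_antisymm (hqs 0) ?_
  have hle : (q 0)⁻¹ ≤ (s 0)⁻¹ := by
    refine le_of_forall_pos_lt_add fun ε hε => ?_
    obtain ⟨n, hn⟩ := hunb ε⁻¹
    have h1 : (w n * q n)⁻¹ < ε := inv_lt_of_inv_lt₀ hε hn
    have h2 := hdiff n
    have h3 : 0 < (w n * s n)⁻¹ := inv_pos.2 (mul_pos (hwpos n) (hspos n))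
    rw [hw0, one_mul, one_mul] at h2
    linarith
  exact (inv_le_inv₀ (hq 0) (hspos 0)).1 hle

/-! ### Branching trees and survival -/

/-- A locally finite forest with levels: each vertex has finitely many children, one level further
down, and at most one parent. -/
structure BranchingTree (V : Type*) where
  /-- The children of a vertex. -/
  ch : V → Finset V
  /-- The level of a vertex. -/
  lev : V → ℕ
  lev_ch : ∀ {v w}, w ∈ ch v → lev w = lev v + 1
  parent_unique : ∀ {u v w}, w ∈ ch u → w ∈ ch v → u = v

namespace BranchingTree

variable {V : Type*} (B : BranchingTree V)

/-- The descendants of a vertex, including the vertex. -/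
def Desc (v : V) : Set V := {w | Relation.ReflTransGen (fun a b => b ∈ B.ch a) v w}

/-- The proper descendants of a vertex. -/
def ProperDesc (v : V) : Set V := ⋃ w ∈ B.ch v, B.Desc w

variable {B}

theorem mem_desc_self (v : V) : v ∈ B.Desc v := Relation.ReflTransGen.refl

theorem desc_subset_properDesc {v w : V} (h : w ∈ B.ch v) : B.Desc w ⊆ B.ProperDesc v :=
  Set.subset_biUnion_of_mem (u := fun w => B.Desc w) h

theorem properDesc_subset_desc (v : V) : B.ProperDesc v ⊆ B.Desc v := by
  refine Set.iUnion₂_subset fun w hw x hx => ?_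
  exact Relation.ReflTransGen.head hw hx

theorem lev_le_of_mem_desc {v w : V} (h : w ∈ B.Desc v) : B.lev v ≤ B.lev w := by
  induction h with
  | refl => exact le_rfl
  | tail _ h ih => rw [B.lev_ch h]; omega

theorem lev_lt_of_mem_properDesc {v w : V} (h : w ∈ B.ProperDesc v) : B.lev v < B.lev w := by
  obtain ⟨u, hu, hw⟩ := Set.mem_iUnion₂.1 h
  have := lev_le_of_mem_desc hw
  rw [B.lev_ch hu] at this
  omega

theorem eq_of_mem_desc {u v w : V} (hu : w ∈ B.Desc u) (hv : w ∈ B.Desc v)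
    (huv : B.lev u = B.lev v) : u = v := by
  induction hu with
  | refl =>
    cases hv with
    | refl => rfl
    | tail h1 h2 =>
      have := lev_le_of_mem_desc h1
      have := B.lev_ch h2
      omega
  | tail h1 h2 ih =>
    cases hv with
    | refl =>
      have := lev_le_of_mem_desc h1
      have := B.lev_ch h2
      omega
    | tail h3 h4 =>
      rw [B.parent_unique h4 h2] at h3
      exact ih h3

theorem disjoint_desc {u v : V} (huv : B.lev u = B.lev v) (hne : u ≠ v) :
    Disjoint (B.Desc u) (B.Desc v) :=
  Set.disjoint_left.2 fun _ hu hv => hne (eq_of_mem_desc hu hv huv)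

theorem disjoint_singleton_properDesc (v : V) : Disjoint {v} (B.ProperDesc v) :=
  Set.disjoint_singleton_left.2 fun h => (lev_lt_of_mem_properDesc h).false

variable (B)

/-- For a set `η` of vertices (those whose edge to the parent is open), `B.Surv η m v` says that
some open path leads from `v` down `m` levels. -/
def Surv (η : V → Prop) : ℕ → V → Prop
  | 0, _ => True
  | m + 1, v => ∃ w ∈ B.ch v, η w ∧ Surv η m w

/-- The vertex `v` is connected to infinity by open paths going down. -/
def Survives (η : V → Prop) (v : V) : Prop := ∀ m, B.Surv η m v

/-- The vertices reached from `v` by open paths going down. -/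
def Reached (η : V → Prop) (v : V) : Set V :=
  {w | Relation.ReflTransGen (fun a b => b ∈ B.ch a ∧ η b) v w}

variable {B} {η : V → Prop}

theorem Surv.of_succ {m : ℕ} {v : V} (h : B.Surv η (m + 1) v) : B.Surv η m v := by
  induction m generalizing v with
  | zero => trivial
  | succ m ih =>
    obtain ⟨w, hw, hη, hs⟩ := h
    exact ⟨w, hw, hη, ih hs⟩

theorem Surv.of_le {m n : ℕ} {v : V} (hmn : m ≤ n) (h : B.Surv η n v) : B.Surv η m v := by
  induction hmn with
  | refl => exact h
  | step _ ih => exact ih h.of_succ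

/-- König's lemma: a surviving vertex has a surviving child. -/
theorem survives_iff {v : V} : B.Survives η v ↔ ∃ w ∈ B.ch v, η w ∧ B.Survives η w := by
  constructor
  · intro h
    by_contra! hcon
    have : ∀ w ∈ B.ch v, ∃ m, η w → ¬ B.Surv η m w := fun w hw => by
      by_cases hη : η w
      · obtain ⟨m, hm⟩ := not_forall.1 (hcon w hw hη)
        exact ⟨m, fun _ => hm⟩
      · exact ⟨0, fun h => absurd h hη⟩
    choose! m hm using this
    obtain ⟨w, hw, hη, hs⟩ := h ((B.ch v).sup m + 1)
    exact hm w hw hη (hs.of_le (Finset.le_sup hw))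
  · rintro ⟨w, hw, hη, hs⟩ m
    exact Surv.of_succ ⟨w, hw, hη, hs m⟩

theorem reached_finite {m : ℕ} {v : V} (h : ¬ B.Surv η m v) : (B.Reached η v).Finite := by
  induction m generalizing v with
  | zero => exact absurd trivial h
  | succ m ih =>
    have hsub : B.Reached η v ⊆ {v} ∪ ⋃ w ∈ {w ∈ (B.ch v : Set V) | η w}, B.Reached η w := by
      intro x hx
      rcases Relation.ReflTransGen.cases_head hx with rfl | ⟨w, ⟨hw, hη⟩, hx⟩
      · exact Or.inl rfl
      · exact Or.inr (Set.mem_biUnion (show w ∈ {w ∈ (B.ch v : Set V) | η w} from ⟨hw, hη⟩) hx)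
    refine Set.Finite.subset ((Set.finite_singleton v).union
      (Set.Finite.biUnion ((B.ch v).finite_toSet.subset (Set.sep_subset _ _)) ?_)) hsub
    rintro w ⟨hw, hη⟩
    exact ih fun hs => h ⟨w, hw, hη, hs⟩

theorem Surv.exists_mem_reached {m : ℕ} {v : V} (h : B.Surv η m v) :
    ∃ w ∈ B.Reached η v, B.lev w = B.lev v + m := by
  induction m generalizing v with
  | zero => exact ⟨v, Relation.ReflTransGen.refl, rfl⟩
  | succ m ih =>
    obtain ⟨w, hw, hη, hs⟩ := h
    obtain ⟨x, hx, hl⟩ := ih hs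
    refine ⟨x, Relation.ReflTransGen.head ⟨hw, hη⟩ hx, ?_⟩
    rw [hl, B.lev_ch hw]
    ring

theorem reached_infinite_iff {v : V} : (B.Reached η v).Infinite ↔ B.Survives η v := by
  refine ⟨fun h m => by_contra fun hm => h (reached_finite hm), fun h hfin => ?_⟩
  obtain ⟨N, hN⟩ := (hfin.image B.lev).bddAbove
  obtain ⟨w, hw, hl⟩ := (h (N + 1)).exists_mem_reached
  have := hN (Set.mem_image_of_mem _ hw)
  omega

end BranchingTree

section

/-! ### Independent fields on a branching tree -/

variable {V Ω : Type*} [mΩ : MeasurableSpace Ω]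

/-- `ℱ S` is the information carried by the edges whose lower endpoint lies in the set `S` of
vertices: disjoint sets carry independent information, and all information is approximated by
that of finitely many levels. -/
structure IndepField (μ : Measure Ω) (B : BranchingTree V) (ℱ : Set V → MeasurableSpace Ω) :
    Prop where
  mono : Monotone ℱ
  le : ∀ S, ℱ S ≤ mΩ
  indep : ∀ S S', Disjoint S S' → Indep (ℱ S) (ℱ S') μ
  le_iSup : ℱ Set.univ ≤ ⨆ n : ℕ, ℱ {y | B.lev y ≤ n}

variable {μ : Measure Ω} {B : BranchingTree V}
  {ℱ : Set V → MeasurableSpace Ω}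

theorem IndepField.measureReal_inter (h : IndepField μ B ℱ) {S T : Set V} (hST : Disjoint S T)
    {E F : Set Ω} (hE : MeasurableSet[ℱ S] E) (hF : MeasurableSet[ℱ T] F) :
    μ.real (E ∩ F) = μ.real E * μ.real F := by
  simp only [measureReal_def]
  rw [(Indep_iff _ _ μ).1 (h.indep S T hST) E F hE hF, ENNReal.toReal_mul]

theorem IndepField.measureReal_inter_biInter [IsProbabilityMeasure μ]
    (h : IndepField μ B ℱ) {D₀ : Set V} {D : V → Set V}
    {E : Set Ω} {A : V → Set Ω} (S : Finset V) (hE : MeasurableSet[ℱ D₀] E)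
    (hA : ∀ v ∈ S, MeasurableSet[ℱ (D v)] (A v)) (hD : (S : Set V).PairwiseDisjoint D)
    (hD₀ : ∀ v ∈ S, Disjoint D₀ (D v)) :
    μ.real (E ∩ ⋂ v ∈ S, A v) = μ.real E * ∏ v ∈ S, μ.real (A v) := by
  classical
  induction S using Finset.induction_on with
  | empty => simp
  | insert v S hv ih =>
    have ih := ih (fun w hw => hA w (Finset.mem_insert_of_mem hw))
      (hD.subset (by simp [Set.subset_insert]))
      (fun w hw => hD₀ w (Finset.mem_insert_of_mem hw))
    have hmeas : MeasurableSet[ℱ (D₀ ∪ ⋃ w ∈ S, D w)] (E ∩ ⋂ w ∈ S, A w) := by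
      refine MeasurableSet.inter (h.mono Set.subset_union_left _ hE) ?_
      refine Finset.measurableSet_biInter S fun w hw => ?_
      exact h.mono ((Set.subset_biUnion_of_mem (u := D) (Finset.mem_coe.2 hw)).trans
        Set.subset_union_right) _ (hA w (Finset.mem_insert_of_mem hw))
    have hdisj : Disjoint (D₀ ∪ ⋃ w ∈ S, D w) (D v) := by
      refine Set.disjoint_union_left.2 ⟨hD₀ v (Finset.mem_insert_self _ _), ?_⟩
      refine Set.disjoint_iUnion₂_left.2 fun w hw => ?_
      exact hD (by simp [hw]) (by simp) (by rintro rfl; exact hv hw)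
    rw [Finset.set_biInter_insert, Set.inter_comm (A v), ← Set.inter_assoc,
      h.measureReal_inter hdisj hmeas (hA v (Finset.mem_insert_self _ _)), ih,
      Finset.prod_insert hv]
    ring

theorem IndepField.exists_approx [IsProbabilityMeasure μ] (h : IndepField μ B ℱ) {I : Set Ω}
    (hI : MeasurableSet[ℱ Set.univ] I) {ε : ℝ} (hε : 0 < ε) :
    ∃ (n : ℕ) (E : Set Ω), MeasurableSet[ℱ {y | B.lev y ≤ n}] E ∧
      μ.real (I \ E) < ε ∧ μ.real (E \ I) < ε := by
  set 𝒜 : Set (Set Ω) := {E | ∃ n : ℕ, MeasurableSet[ℱ {y | B.lev y ≤ n}] E} with h𝒜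
  have hmono : Monotone fun n : ℕ => ℱ {y | B.lev y ≤ n} :=
    fun m n hmn => h.mono fun y hy => le_trans hy hmn
  have halg : IsSetAlgebra 𝒜 := by
    refine ⟨⟨0, @MeasurableSet.empty _ (_)⟩, fun E ⟨n, hE⟩ => ⟨n, hE.compl⟩, ?_⟩
    rintro E F ⟨m, hE⟩ ⟨n, hF⟩
    exact ⟨max m n, (hmono (le_max_left m n) _ hE).union (hmono (le_max_right m n) _ hF)⟩
  have hgen : ℱ Set.univ = MeasurableSpace.generateFrom 𝒜 := by
    refine le_antisymm (h.le_iSup.trans (iSup_le fun n E hE => ?_))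
      (MeasurableSpace.generateFrom_le fun E ⟨n, hE⟩ => h.mono (Set.subset_univ _) _ hE)
    exact MeasurableSpace.measurableSet_generateFrom ⟨n, hE⟩
  have hle := h.le Set.univ
  have hdense := Measure.MeasureDense.of_generateFrom_isSetAlgebra_finite
    (m := ℱ Set.univ) (μ := μ.trim hle) halg hgen
  obtain ⟨E, ⟨n, hE⟩, hlt⟩ := @Measure.MeasureDense.approx Ω (ℱ Set.univ) _ _ hdense I hI
    (measure_ne_top _ _) ε hε
  have hE' := h.mono (Set.subset_univ _) _ hE
  rw [trim_measurableSet_eq hle (hI.symmDiff hE')] at hlt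
  have hreal : μ.real (symmDiff I E) < ε := by
    rw [measureReal_def]
    exact (ENNReal.lt_ofReal_iff_toReal_lt (measure_ne_top _ _)).1 hlt
  refine ⟨n, E, hE, (measureReal_mono ?_).trans_lt hreal, (measureReal_mono ?_).trans_lt hreal⟩
  · exact Set.subset_union_left
  · exact Set.subset_union_right

/-! ### Events determined by the descendants of a vertex -/

/-- Events `I v` attached to the vertices such that, almost surely, `I v` occurs if and only if
`O w` and `I w` occur for some child `w`; here `O w` is the event that the edge above `w` is open.
The probabilities depend only on the level. -/
structure IsBranchingEvent (μ : Measure Ω) (B : BranchingTree V) (ℱ : Set V → MeasurableSpace Ω)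
    (O I : V → Set Ω) (p q : ℕ → ℝ) : Prop where
  measurable_open : ∀ v, MeasurableSet[ℱ {v}] (O v)
  measurable : ∀ v, MeasurableSet[ℱ (B.ProperDesc v)] (I v)
  prob_open : ∀ v, ∀ w ∈ B.ch v, μ.real (O w) = p (B.lev w)
  prob : ∀ v, μ.real (I v) = q (B.lev v)
  ae_iff : ∀ v, ∀ᵐ x ∂μ, x ∈ I v ↔ ∃ w ∈ B.ch v, x ∈ O w ∧ x ∈ I w

variable {O I : V → Set Ω} {p q : ℕ → ℝ}

theorem IsBranchingEvent.recursion [IsProbabilityMeasure μ]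
    (hI : IsBranchingEvent μ B ℱ O I p q) (h : IndepField μ B ℱ)
    (v : V) :
    q (B.lev v) = 1 - (1 - p (B.lev v + 1) * q (B.lev v + 1)) ^ (B.ch v).card := by
  have hdesc : ∀ w, {w} ∪ B.ProperDesc w ⊆ B.Desc w := fun w =>
    Set.union_subset (Set.singleton_subset_iff.2 (BranchingTree.mem_desc_self w))
      (BranchingTree.properDesc_subset_desc w)
  have hm : ∀ w, MeasurableSet[ℱ (B.Desc w)] (O w ∩ I w) := fun w =>
    MeasurableSet.inter (h.mono (Set.subset_union_left.trans (hdesc w)) _ (hI.measurable_open w))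
      (h.mono (Set.subset_union_right.trans (hdesc w)) _ (hI.measurable w))
  have h1 : μ.real (I v)ᶜ = μ.real (Set.univ ∩ ⋂ w ∈ B.ch v, (O w ∩ I w)ᶜ) := by
    refine measureReal_congr ?_
    filter_upwards [hI.ae_iff v] with x hx
    refine propext ?_
    change x ∉ I v ↔ x ∈ Set.univ ∩ ⋂ w ∈ B.ch v, (O w ∩ I w)ᶜ
    rw [hx]
    simp
  have h2 : ∀ w ∈ B.ch v,
      μ.real (O w ∩ I w)ᶜ = 1 - p (B.lev v + 1) * q (B.lev v + 1) := by
    intro w hw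
    rw [probReal_compl_eq_one_sub (h.le _ _ (hm w)),
      h.measureReal_inter (BranchingTree.disjoint_singleton_properDesc w) (hI.measurable_open w)
        (hI.measurable w), hI.prob_open v w hw, hI.prob, B.lev_ch hw]
  have h3 := h.measureReal_inter_biInter (D₀ := ∅) (D := B.Desc) (E := Set.univ)
    (A := fun w => (O w ∩ I w)ᶜ) (B.ch v) MeasurableSet.univ (fun w _ => (hm w).compl)
    (fun u hu w hw hne => BranchingTree.disjoint_desc
      (by rw [B.lev_ch hu, B.lev_ch hw]) hne) (fun _ _ => Set.empty_disjoint _)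
  rw [probReal_compl_eq_one_sub (h.le _ _ (hI.measurable v)), hI.prob, h3,
    Finset.prod_congr rfl h2, Finset.prod_const, probReal_univ, one_mul] at h1
  linarith

/-- If the probability at level `0` is positive, then there are vertices on each level, and the
probability is positive on each level: a value of `q` at an empty level would be arbitrary. -/
theorem IsBranchingEvent.exists_lev [IsProbabilityMeasure μ]
    (hI : IsBranchingEvent μ B ℱ O I p q) (h : IndepField μ B ℱ)
    {ρ : V} (hρ : B.lev ρ = 0) (hq : 0 < q 0) (n : ℕ) : ∃ v, B.lev v = n ∧ 0 < q n := by
  induction n with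
  | zero => exact ⟨ρ, hρ, hq⟩
  | succ n ih =>
    obtain ⟨v, hv, hqn⟩ := ih
    have hrec := hI.recursion h v
    rw [hv] at hrec
    have hne : (B.ch v).Nonempty := by
      by_contra hne
      rw [Finset.not_nonempty_iff_eq_empty.1 hne] at hrec
      simp only [Finset.card_empty, pow_zero, sub_self] at hrec
      exact hqn.ne' hrec
    obtain ⟨w, hw⟩ := hne
    have hlw : B.lev w = n + 1 := by rw [B.lev_ch hw, hv]
    refine ⟨w, hlw, lt_of_le_of_ne ?_ fun h0 => ?_⟩
    · rw [← hlw, ← hI.prob w]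
      exact measureReal_nonneg
    · rw [← h0] at hrec
      simp only [mul_zero, sub_zero, one_pow, sub_self] at hrec
      exact hqn.ne' hrec

/-! ### The vertices connected to the root -/

namespace BranchingTree

variable (B)

open Classical in
/-- The descendants of `ρ` in generation `n` which are joined to `ρ` by open edges. -/
noncomputable def gen (ρ : V) (η : V → Prop) : ℕ → Finset V
  | 0 => {ρ}
  | n + 1 => ((gen ρ η n).biUnion B.ch).filter η

variable {B} {ρ : V} {η : V → Prop}

theorem mem_gen_succ {n : ℕ} {w : V} :
    w ∈ B.gen ρ η (n + 1) ↔ (∃ v ∈ B.gen ρ η n, w ∈ B.ch v) ∧ η w := by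
  simp [gen]

theorem mem_gen_succ_iff {n : ℕ} {v w : V} (hw : w ∈ B.ch v) :
    w ∈ B.gen ρ η (n + 1) ↔ v ∈ B.gen ρ η n ∧ η w := by
  rw [mem_gen_succ]
  refine and_congr_left fun _ => ⟨?_, fun h => ⟨v, h, hw⟩⟩
  rintro ⟨u, hu, hwu⟩
  rwa [B.parent_unique hw hwu]

theorem gen_subset_gen_true (n : ℕ) : B.gen ρ η n ⊆ B.gen ρ (fun _ => True) n := by
  induction n with
  | zero => exact subset_rfl
  | succ n ih =>
    intro w hw
    obtain ⟨⟨v, hv, hwv⟩, -⟩ := mem_gen_succ.1 hw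
    exact mem_gen_succ.2 ⟨⟨v, ih hv, hwv⟩, trivial⟩

theorem lev_of_mem_gen (hρ : B.lev ρ = 0) {n : ℕ} {v : V} (hv : v ∈ B.gen ρ η n) :
    B.lev v = n := by
  induction n generalizing v with
  | zero => rw [Finset.mem_singleton.1 hv, hρ]
  | succ n ih =>
    obtain ⟨⟨u, hu, hvu⟩, -⟩ := mem_gen_succ.1 hv
    rw [B.lev_ch hvu, ih hu]

theorem card_gen_true (hρ : B.lev ρ = 0) {d : ℕ → ℕ} (hd : ∀ v, (B.ch v).card = d (B.lev v))
    (n : ℕ) : (B.gen ρ (fun _ => True) n).card = ∏ i ∈ Finset.range n, d i := by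
  classical
  induction n with
  | zero => simp [gen]
  | succ n ih =>
    have h1 : B.gen ρ (fun _ => True) (n + 1) = (B.gen ρ (fun _ => True) n).biUnion B.ch := by
      ext w
      simp [mem_gen_succ]
    rw [h1, Finset.card_biUnion, Finset.sum_congr rfl (fun v hv => by
        rw [hd v, lev_of_mem_gen hρ hv]), Finset.sum_const, ih, smul_eq_mul,
      Finset.prod_range_succ]
    intro u hu v hv hne
    refine Finset.disjoint_left.2 fun w hwu hwv => hne (B.parent_unique hwu hwv)

end BranchingTree

variable {ρ : V}

theorem IsBranchingEvent.measurable_mem_gen (hI : IsBranchingEvent μ B ℱ O I p q)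
    (h : IndepField μ B ℱ) (n : ℕ) {v : V} (hv : v ∈ B.gen ρ (fun _ => True) n)
    (hρ : B.lev ρ = 0) :
    MeasurableSet[ℱ {y | B.lev y ≤ n}] {x | v ∈ B.gen ρ (fun y => x ∈ O y) n} := by
  induction n generalizing v with
  | zero => simp [BranchingTree.gen]
  | succ n ih =>
    have hlev := BranchingTree.lev_of_mem_gen hρ hv
    obtain ⟨⟨u, hu, hvu⟩, -⟩ := BranchingTree.mem_gen_succ.1 hv
    simp_rw [BranchingTree.mem_gen_succ_iff hvu]
    refine MeasurableSet.inter (h.mono (fun y hy => ?_) _ (ih hu))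
      (h.mono (fun y hy => ?_) _ (hI.measurable_open v))
    · exact le_trans hy (Nat.le_succ n)
    · rw [Set.mem_singleton_iff.1 hy]
      exact hlev.le

theorem IsBranchingEvent.prob_mem_gen [IsProbabilityMeasure μ]
    (hI : IsBranchingEvent μ B ℱ O I p q)
    (h : IndepField μ B ℱ) (n : ℕ) {v : V} (hv : v ∈ B.gen ρ (fun _ => True) n)
    (hρ : B.lev ρ = 0) :
    μ.real {x | v ∈ B.gen ρ (fun y => x ∈ O y) n} = ∏ i ∈ Finset.range n, p (i + 1) := by
  induction n generalizing v with
  | zero =>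
    have : v = ρ := Finset.mem_singleton.1 hv
    simp [BranchingTree.gen, this]
  | succ n ih =>
    have hlev := BranchingTree.lev_of_mem_gen hρ hv
    obtain ⟨⟨u, hu, hvu⟩, -⟩ := BranchingTree.mem_gen_succ.1 hv
    simp_rw [BranchingTree.mem_gen_succ_iff hvu]
    have hdisj : Disjoint {y | B.lev y ≤ n} {v} :=
      Set.disjoint_singleton_right.2 fun hle : B.lev v ≤ n => by omega
    have := h.measureReal_inter hdisj (hI.measurable_mem_gen h n hu hρ) (hI.measurable_open v)
    rw [ih hu, hI.prob_open u v hvu, hlev] at this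
    rw [Finset.prod_range_succ]
    exact this

theorem IsBranchingEvent.ae_exists_mem_gen (hI : IsBranchingEvent μ B ℱ O I p q) (n : ℕ) :
    ∀ᵐ x ∂μ, x ∈ I ρ → ∃ v ∈ B.gen ρ (fun y => x ∈ O y) n, x ∈ I v := by
  induction n with
  | zero => exact Filter.Eventually.of_forall fun x hx => ⟨ρ, by simp [BranchingTree.gen], hx⟩
  | succ n ih =>
    have hall : ∀ᵐ x ∂μ, ∀ v ∈ B.gen ρ (fun _ => True) n,
        (x ∈ I v ↔ ∃ w ∈ B.ch v, x ∈ O w ∧ x ∈ I w) :=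
      (Finset.eventually_all _).2 fun v _ => hI.ae_iff v
    filter_upwards [ih, hall] with x hx hrec hxI
    obtain ⟨v, hv, hxv⟩ := hx hxI
    obtain ⟨w, hw, hO, hIw⟩ := (hrec v (BranchingTree.gen_subset_gen_true n hv)).1 hxv
    exact ⟨w, BranchingTree.mem_gen_succ.2 ⟨⟨v, hv, hw⟩, hO⟩, hIw⟩

/-- Markov's inequality for the number of vertices of level `n` connected to the root. -/
theorem IsBranchingEvent.markov_card_gen [IsProbabilityMeasure μ]
    (hI : IsBranchingEvent μ B ℱ O I p q)
    (h : IndepField μ B ℱ) (hρ : B.lev ρ = 0) {d : ℕ → ℕ}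
    (hd : ∀ v, (B.ch v).card = d (B.lev v)) (n : ℕ) (K : ℝ) :
    K * μ.real {x | K ≤ ((B.gen ρ (fun y => x ∈ O y) n).card : ℝ)} ≤
      ∏ i ∈ Finset.range n, d i * p (i + 1) := by
  classical
  set L := B.gen ρ (fun _ => True) n with hL
  have hm : ∀ v ∈ L, MeasurableSet {x | v ∈ B.gen ρ (fun y => x ∈ O y) n} := fun v hv =>
    h.le _ _ (hI.measurable_mem_gen h n hv hρ)
  have hcard : ∀ x, ((B.gen ρ (fun y => x ∈ O y) n).card : ℝ) =
      ∑ v ∈ L, Set.indicator {x | v ∈ B.gen ρ (fun y => x ∈ O y) n} (fun _ => (1 : ℝ)) x := by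
    intro x
    simp only [Set.indicator_apply, Set.mem_ofPred_eq]
    rw [Finset.sum_ite_mem, Finset.inter_eq_right.2 (BranchingTree.gen_subset_gen_true n)]
    simp
  have hint : ∀ v ∈ L, Integrable
      (Set.indicator {x | v ∈ B.gen ρ (fun y => x ∈ O y) n} (fun _ => (1 : ℝ))) μ := fun v hv =>
    (integrable_const 1).indicator (hm v hv)
  have hE : ∫ x, ((B.gen ρ (fun y => x ∈ O y) n).card : ℝ) ∂μ =
      ∏ i ∈ Finset.range n, d i * p (i + 1) := by
    simp_rw [hcard]
    rw [integral_finsetSum _ hint, Finset.sum_congr rfl (fun v hv => by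
        rw [integral_indicator_const _ (hm v hv), hI.prob_mem_gen h n hv hρ]),
      Finset.sum_const, BranchingTree.card_gen_true hρ hd, Finset.prod_mul_distrib]
    simp
  rw [← hE]
  refine mul_meas_ge_le_integral_of_nonneg (Filter.Eventually.of_forall fun x => Nat.cast_nonneg _)
    ?_ K
  simp_rw [hcard]
  exact integrable_finsetSum _ hint

/-- On an event `E` determined by the first `n` levels, when fewer than `K` vertices of level `n`
are connected to the root, the event `I ρ` fails with conditional probability at least `κ`: this is
at most `(1 - q n) ^ k`, the probability that `I v` fails for `k` given vertices `v` of level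
`n`. -/
theorem IsBranchingEvent.le_prob_diff [IsProbabilityMeasure μ]
    (hI : IsBranchingEvent μ B ℱ O I p q)
    (h : IndepField μ B ℱ) (hρ : B.lev ρ = 0) (n : ℕ) {E : Set Ω}
    (hE : MeasurableSet[ℱ {y | B.lev y ≤ n}] E) {K κ : ℝ}
    (hκ : ∀ k : ℕ, (k : ℝ) < K → κ ≤ (1 - q n) ^ k) :
    κ * μ.real (E ∩ {x | ((B.gen ρ (fun y => x ∈ O y) n).card : ℝ) < K}) ≤ μ.real (E \ I ρ) := by
  classical
  -- The event is split according to the set of vertices of level `n` connected to the root.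
  set C : Ω → Finset V := fun x => B.gen ρ (fun y => x ∈ O y) n with hC
  set L := B.gen ρ (fun _ => True) n with hL
  have hCL : ∀ x, C x ⊆ L := fun x => BranchingTree.gen_subset_gen_true n
  set P := L.powerset.filter fun S => (S.card : ℝ) < K with hP
  have hmC : ∀ S ∈ P, MeasurableSet[ℱ {y | B.lev y ≤ n}] {x | C x = S} := by
    intro S hS
    have hSL : S ⊆ L := Finset.mem_powerset.1 (Finset.mem_filter.1 hS).1
    have : {x | C x = S} = ⋂ v ∈ L, {x | v ∈ C x ↔ v ∈ S} := by
      ext x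
      simp only [Set.mem_ofPred_eq, Set.mem_iInter]
      refine ⟨fun hx v _ => by rw [hx], fun hx => ?_⟩
      ext v
      by_cases hv : v ∈ L
      · exact hx v hv
      · exact iff_of_false (fun hv' => hv (hCL x hv')) fun hv' => hv (hSL hv')
    rw [this]
    refine Finset.measurableSet_biInter L fun v hv => ?_
    have hmv := hI.measurable_mem_gen h n hv hρ
    by_cases hvS : v ∈ S
    · simpa only [hvS, iff_true] using hmv
    · simpa only [hvS, iff_false] using! hmv.compl
  have hterm : ∀ S ∈ P, κ * μ.real (E ∩ {x | C x = S}) ≤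
      μ.real ((E ∩ {x | C x = S}) ∩ ⋂ v ∈ S, (I v)ᶜ) := by
    intro S hS
    obtain ⟨hSL, hSK⟩ := Finset.mem_filter.1 hS
    have hSL : S ⊆ L := Finset.mem_powerset.1 hSL
    have hlev : ∀ v ∈ S, B.lev v = n := fun v hv => BranchingTree.lev_of_mem_gen hρ (hSL hv)
    rw [h.measureReal_inter_biInter (D₀ := {y | B.lev y ≤ n}) (D := B.ProperDesc) S
      (hE.inter (hmC S hS)) (fun v _ => (hI.measurable v).compl), Finset.prod_congr rfl
      (fun v hv => by rw [probReal_compl_eq_one_sub (h.le _ _ (hI.measurable v)), hI.prob,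
        hlev v hv]), Finset.prod_const, mul_comm]
    · exact mul_le_mul_of_nonneg_left (hκ _ hSK) measureReal_nonneg
    · intro u hu v hv hne
      exact (BranchingTree.disjoint_desc (by rw [hlev u hu, hlev v hv]) hne).mono
        (BranchingTree.properDesc_subset_desc u) (BranchingTree.properDesc_subset_desc v)
    · intro v hv
      refine Set.disjoint_left.2 fun y (hy : B.lev y ≤ n) hy' => ?_
      have := BranchingTree.lev_lt_of_mem_properDesc hy'
      rw [hlev v hv] at this
      omega
  have hm1 : ∀ S ∈ P, MeasurableSet (E ∩ {x | C x = S}) := fun S hS =>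
    h.le _ _ (hE.inter (hmC S hS))
  have hm2 : ∀ S ∈ P, MeasurableSet ((E ∩ {x | C x = S}) ∩ ⋂ v ∈ S, (I v)ᶜ) := fun S hS =>
    (hm1 S hS).inter (Finset.measurableSet_biInter S fun v _ =>
      (h.le _ _ (hI.measurable v)).compl)
  have hdisj1 : (P : Set (Finset V)).PairwiseDisjoint fun S => E ∩ {x | C x = S} := by
    intro S _ S' _ hne
    refine Set.disjoint_left.2 fun x hx hx' => hne ?_
    rw [← hx.2, ← hx'.2]
  have hdisj2 : (P : Set (Finset V)).PairwiseDisjoint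
      fun S => (E ∩ {x | C x = S}) ∩ ⋂ v ∈ S, (I v)ᶜ := fun S hS S' hS' hne =>
    (hdisj1 hS hS' hne).mono Set.inter_subset_left Set.inter_subset_left
  have hsplit : E ∩ {x | ((C x).card : ℝ) < K} = ⋃ S ∈ P, E ∩ {x | C x = S} := by
    ext x
    simp only [Set.mem_inter_iff, Set.mem_ofPred_eq, Set.mem_iUnion, exists_prop]
    refine ⟨fun hx => ⟨C x, ?_, hx.1, rfl⟩, fun ⟨S, hS, hxE, hxS⟩ => ⟨hxE, ?_⟩⟩
    · exact Finset.mem_filter.2 ⟨Finset.mem_powerset.2 (hCL x), hx.2⟩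
    · rw [hxS]
      exact (Finset.mem_filter.1 hS).2
  calc κ * μ.real (E ∩ {x | ((C x).card : ℝ) < K})
      = ∑ S ∈ P, κ * μ.real (E ∩ {x | C x = S}) := by
        rw [hsplit, measureReal_biUnion_finset hdisj1 hm1, Finset.mul_sum]
    _ ≤ ∑ S ∈ P, μ.real ((E ∩ {x | C x = S}) ∩ ⋂ v ∈ S, (I v)ᶜ) := Finset.sum_le_sum hterm
    _ = μ.real (⋃ S ∈ P, (E ∩ {x | C x = S}) ∩ ⋂ v ∈ S, (I v)ᶜ) :=
        (measureReal_biUnion_finset hdisj2 hm2).symm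
    _ ≤ μ.real (E \ I ρ) := by
        refine ENNReal.toReal_mono (measure_ne_top _ _) (measure_mono_ae ?_)
        filter_upwards [hI.ae_exists_mem_gen (ρ := ρ) n] with x hx hxU
        obtain ⟨S, hS, ⟨hxE, hxS⟩, hxI⟩ := by
          simpa only [Set.mem_iUnion₂, exists_prop] using Set.mem_iUnion₂.1 hxU
        refine ⟨hxE, fun hxρ => ?_⟩
        obtain ⟨v, hv, hxv⟩ := hx hxρ
        have hvS : v ∈ S := by
          rw [← hxS]
          exact hv
        exact Set.mem_iInter₂.1 hxI v hvS hxv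

theorem exp_le_one_sub {b y : ℝ} (hy : 0 ≤ y) (hyb : y ≤ b) (hb : b < 1) :
    Real.exp (-(y / (1 - b))) ≤ 1 - y := by
  have h1 : 0 < 1 - y := by linarith
  have h2 := Real.one_sub_inv_le_log_of_pos h1
  have h3 : y / (1 - y) ≤ y / (1 - b) :=
    div_le_div_of_nonneg_left hy (by linarith) (by linarith)
  have h4 : 1 - (1 - y)⁻¹ = -(y / (1 - y)) := by field_simp; ring
  calc Real.exp (-(y / (1 - b))) ≤ Real.exp (Real.log (1 - y)) := Real.exp_le_exp.2 (by linarith)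
    _ = 1 - y := Real.exp_log h1

/-- If the event `I ρ` has positive probability, then the mean number of vertices `v` of level `n`
which are connected to the root and satisfy `I v` is unbounded. Otherwise the number of
vertices of level `n` connected to the root would leave, with a probability bounded away from
`0` and uniformly in `n`, a chance bounded away from `0` for the failure of `I ρ`; but for
large `n` the first `n` levels nearly determine whether `I ρ` occurs. -/
theorem IsBranchingEvent.mean_unbounded [IsProbabilityMeasure μ]
    (hI : IsBranchingEvent μ B ℱ O I p q)
    (h : IndepField μ B ℱ) (hρ : B.lev ρ = 0) {d : ℕ → ℕ}
    (hd : ∀ v, (B.ch v).card = d (B.lev v)) (hq0 : 0 < q 0) {b : ℝ} (hb : b < 1)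
    (hp : ∀ n, 0 < p (n + 1) ∧ p (n + 1) ≤ b) (C : ℝ) :
    ∃ n, C < (∏ i ∈ Finset.range n, d i * p (i + 1)) * q n := by
  by_contra! hC
  set w : ℕ → ℝ := fun n => ∏ i ∈ Finset.range n, d i * p (i + 1) with hw
  have hrec : ∀ n, q n = 1 - (1 - p (n + 1) * q (n + 1)) ^ d n := by
    intro n
    obtain ⟨v, hv, -⟩ := hI.exists_lev h hρ hq0 n
    have := hI.recursion h v
    rwa [hd, hv] at this
  have hqpos : ∀ n, 0 < q n := fun n => (hI.exists_lev h hρ hq0 n).choose_spec.2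
  have hqle : ∀ n, q n ≤ 1 := by
    intro n
    obtain ⟨v, hv, -⟩ := hI.exists_lev h hρ hq0 n
    rw [← hv, ← hI.prob v]
    exact measureReal_le_one
  have hdpos : ∀ n, (0 : ℝ) < d n := by
    intro n
    refine Nat.cast_pos.2 (Nat.pos_of_ne_zero fun h0 => ?_)
    have := hrec n
    rw [h0, pow_zero, sub_self] at this
    exact (hqpos n).ne' this
  have hwpos : ∀ n, 0 < w n := fun n => Finset.prod_pos fun i _ => mul_pos (hdpos i) (hp i).1
  have hb' : 0 < 1 - b := by linarith
  -- By Markov's inequality, fewer than `M * w n` vertices of level `n` are connected to the root,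
  -- up to probability `q 0 / 4`; then `I ρ` fails with conditional probability at least `κ`.
  set M : ℝ := 4 / q 0 with hM
  have hMpos : 0 < M := by positivity
  set κ : ℝ := Real.exp (-(M * C / (1 - b))) with hκ
  have hκpos : 0 < κ := Real.exp_pos _
  have hκle : ∀ n, ∀ k : ℕ, (k : ℝ) < M * w n → κ ≤ (1 - q n) ^ k := by
    intro n k hk
    set y := p (n + 1) * q (n + 1) with hy
    have hy0 : 0 ≤ y := (mul_pos (hp n).1 (hqpos _)).le
    have hyb : y ≤ b := by
      calc y ≤ p (n + 1) * 1 := mul_le_mul_of_nonneg_left (hqle _) (hp n).1.le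
        _ ≤ b := by simpa using (hp n).2
    have h1 : 1 - q n = (1 - y) ^ d n := by
      rw [hrec n]
      ring
    have hwn : w (n + 1) = w n * (d n * p (n + 1)) := Finset.prod_range_succ _ _
    rw [h1, ← pow_mul]
    calc κ ≤ Real.exp (((d n * k : ℕ) : ℝ) * (-(y / (1 - b)))) := by
          refine Real.exp_le_exp.2 ?_
          have h2 : ((d n * k : ℕ) : ℝ) * y ≤ M * C := by
            calc ((d n * k : ℕ) : ℝ) * y = k * (d n * y) := by push_cast; ring
              _ ≤ M * w n * (d n * y) :=
                  mul_le_mul_of_nonneg_right hk.le (mul_nonneg (hdpos n).le hy0)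
              _ = M * (w (n + 1) * q (n + 1)) := by rw [hwn, hy]; ring
              _ ≤ M * C := mul_le_mul_of_nonneg_left (hC (n + 1)) hMpos.le
          rw [mul_neg, ← mul_div_assoc]
          exact neg_le_neg (div_le_div_of_nonneg_right h2 hb'.le)
      _ = Real.exp (-(y / (1 - b))) ^ (d n * k) := by rw [Real.exp_nat_mul]
      _ ≤ (1 - y) ^ (d n * k) :=
          pow_le_pow_left₀ (Real.exp_pos _).le (exp_le_one_sub hy0 hyb hb) _
  have hIuniv : MeasurableSet[ℱ Set.univ] (I ρ) := h.mono (Set.subset_univ _) _ (hI.measurable ρ)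
  obtain ⟨n, E, hE, hIE, hEI⟩ := h.exists_approx hIuniv
    (ε := min (q 0 / 4) (κ * (q 0 / 2))) (by positivity)
  have hIE := hIE.trans_le (min_le_left _ _)
  have hEI := hEI.trans_le (min_le_right _ _)
  have h1 : q 0 ≤ μ.real E + q 0 / 4 := by
    have : μ.real (I ρ) ≤ μ.real E + μ.real (I ρ \ E) :=
      (measureReal_mono (fun x hx => by
        by_cases hxE : x ∈ E
        · exact Or.inl hxE
        · exact Or.inr ⟨hx, hxE⟩)).trans (measureReal_union_le _ _)
    rw [hI.prob, hρ] at this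
    linarith
  set Z : Ω → ℝ := fun x => ((B.gen ρ (fun y => x ∈ O y) n).card : ℝ) with hZ
  have h2 : μ.real {x | M * w n ≤ Z x} ≤ q 0 / 4 := by
    have hmk := hI.markov_card_gen h hρ hd n (M * w n)
    have : M * w n * μ.real {x | M * w n ≤ Z x} ≤ M * w n * (q 0 / 4) := by
      calc M * w n * μ.real {x | M * w n ≤ Z x} ≤ w n := hmk
        _ = M * w n * (q 0 / 4) := by rw [hM]; field_simp
    exact le_of_mul_le_mul_left this (mul_pos hMpos (hwpos n))
  have h3 : μ.real E ≤ μ.real (E ∩ {x | Z x < M * w n}) + μ.real {x | M * w n ≤ Z x} :=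
    (measureReal_mono (fun x hx => by
      rcases lt_or_ge (Z x) (M * w n) with hlt | hge
      · exact Or.inl ⟨hx, hlt⟩
      · exact Or.inr hge)).trans (measureReal_union_le _ _)
  have h4 := hI.le_prob_diff h hρ n hE (hκle n)
  have h5 : κ * (q 0 / 2) ≤ κ * μ.real (E ∩ {x | Z x < M * w n}) :=
    mul_le_mul_of_nonneg_left (by linarith) hκpos.le
  exact absurd hEI (not_lt.2 (h5.trans h4))

end

section

/-! ### Sets of rational times -/

/-- The rational times in some neighbourhood of `t` all belong to the set `A`. -/
def IntAt (A : ℚ → Prop) (t : ℚ) : Prop := ∃ k : ℕ, ∀ r : ℚ, |r - t| < 1 / ((k : ℚ) + 1) → A r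

/-- The set `A` is closed in the subspace `ℚ` of the line. -/
def RelClosed (A : ℚ → Prop) : Prop := ∀ t, ¬ A t → IntAt (fun r => ¬ A r) t

theorem intAt_iff {A : ℚ → Prop} {t : ℚ} : IntAt A t ↔ ∃ ε > 0, ∀ r, |r - t| < ε → A r := by
  refine ⟨fun ⟨k, hk⟩ => ⟨1 / ((k : ℚ) + 1), by positivity, hk⟩, fun ⟨ε, hε, h⟩ => ?_⟩
  obtain ⟨k, hk⟩ := exists_nat_one_div_lt hε
  exact ⟨k, fun r hr => h r (hr.trans hk)⟩

theorem IntAt.self {A : ℚ → Prop} {t : ℚ} (h : IntAt A t) : A t := by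
  obtain ⟨k, hk⟩ := h
  exact hk t (by simp only [sub_self, abs_zero]; positivity)

theorem IntAt.mono {A B : ℚ → Prop} {t : ℚ} (h : IntAt A t) (hAB : ∀ r, A r → B r) :
    IntAt B t := by
  obtain ⟨k, hk⟩ := h
  exact ⟨k, fun r hr => hAB r (hk r hr)⟩

theorem intAt_and {A B : ℚ → Prop} {t : ℚ} :
    IntAt (fun r => A r ∧ B r) t ↔ IntAt A t ∧ IntAt B t := by
  refine ⟨fun h => ⟨h.mono fun _ => And.left, h.mono fun _ => And.right⟩, fun ⟨hA, hB⟩ => ?_⟩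
  obtain ⟨ε, hε, hA⟩ := intAt_iff.1 hA
  obtain ⟨δ, hδ, hB⟩ := intAt_iff.1 hB
  exact intAt_iff.2 ⟨min ε δ, lt_min hε hδ, fun r hr =>
    ⟨hA r (hr.trans_le (min_le_left _ _)), hB r (hr.trans_le (min_le_right _ _))⟩⟩

theorem intAt_shift {A : ℚ → Prop} {r : ℚ} : IntAt (fun t => A (t + r)) 0 ↔ IntAt A r := by
  constructor
  · rintro ⟨k, hk⟩
    refine ⟨k, fun t ht => ?_⟩
    simpa using hk (t - r) (by simpa using ht)
  · rintro ⟨k, hk⟩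
    exact ⟨k, fun t ht => hk (t + r) (by simpa using ht)⟩

theorem RelClosed.or {A B : ℚ → Prop} (hA : RelClosed A) (hB : RelClosed B) :
    RelClosed fun r => A r ∨ B r := by
  intro t ht
  rw [not_or] at ht
  exact (intAt_and.2 ⟨hA t ht.1, hB t ht.2⟩).mono fun r hr => not_or.2 hr

theorem relClosed_of_isClosed {K : Set ℝ} (hK : IsClosed K) :
    RelClosed fun r : ℚ => (r : ℝ) ∈ K := by
  intro t ht
  obtain ⟨ε, hε, h⟩ := Metric.isOpen_iff.1 hK.isOpen_compl (t : ℝ) ht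
  obtain ⟨k, hk⟩ := exists_nat_one_div_lt hε
  refine ⟨k, fun r hr => h ?_⟩
  rw [Metric.mem_ball, Real.dist_eq]
  refine lt_trans ?_ hk
  have : ((|r - t| : ℚ) : ℝ) < ((1 / ((k : ℚ) + 1) : ℚ) : ℝ) := Rat.cast_lt.2 hr
  push_cast at this
  exact this

theorem intAt_of_mem_interior {K : Set ℝ} {t : ℚ} (ht : (t : ℝ) ∈ interior K) :
    IntAt (fun r : ℚ => (r : ℝ) ∈ K) t := by
  have := relClosed_of_isClosed (K := (interior K)ᶜ) isOpen_interior.isClosed_compl t (by simpa)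
  exact this.mono fun r hr => interior_subset (not_not.1 hr)

theorem measurableSet_intAt {Ω : Type*} {m : MeasurableSpace Ω} {A : Ω → ℚ → Prop}
    (hA : ∀ r, MeasurableSet[m] {x | A x r}) (t : ℚ) :
    MeasurableSet[m] {x | IntAt (A x) t} := by
  unfold IntAt
  simp only [Set.ofPred_exists, Set.ofPred_forall]
  exact MeasurableSet.iUnion fun k => MeasurableSet.iInter fun r => MeasurableSet.iInter fun _ =>
    hA r

/-! ### Interiors of unions of independent random sets -/

variable {Ω : Type*} [mΩ : MeasurableSpace Ω] {μ : Measure Ω} [IsProbabilityMeasure μ]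

/-- Let `A` and `B` be independent random sets of times, `A` closed, such that the probability that
a given time is an interior point of `B` does not depend on the time. If `0` is an interior
point of the union, then almost surely it is an interior point of `A` or of `B`.

If `0` is not interior to `A`, then there are times outside `A` arbitrarily close to `0`. Near
such a time `t` the union is covered by `B`, so that `t` is an interior point of `B`; as `t`
can be chosen independently of `B`, this has the probability that `0` is an interior point of
`B`. -/
theorem ae_intAt_or {m₁ m₂ : MeasurableSpace Ω} (hm₁ : m₁ ≤ mΩ) (hm₂ : m₂ ≤ mΩ)
    (hind : Indep m₁ m₂ μ) {A B : Ω → ℚ → Prop}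
    (hA : ∀ r, MeasurableSet[m₁] {x | A x r}) (hB : ∀ r, MeasurableSet[m₂] {x | B x r})
    (hcl : ∀ᵐ x ∂μ, RelClosed (A x))
    (hst : ∀ t, μ {x | IntAt (B x) t} = μ {x | IntAt (B x) 0}) :
    ∀ᵐ x ∂μ, IntAt (fun r => A x r ∨ B x r) 0 → IntAt (A x) 0 ∨ IntAt (B x) 0 := by
  set c := μ {x | IntAt (B x) 0} with hc
  -- On `a k`, the set `A` omits some time close to `0`; on `H k`, moreover, the union covers all
  -- such times, while `0` is not interior to `A`.
  set a : ℕ → Set Ω := fun k => {x | ∃ r : ℚ, |r - 0| < 1 / ((k : ℚ) + 1) ∧ ¬ A x r} with ha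
  set F : Set Ω := {x | ¬ IntAt (A x) 0} with hF
  set H : ℕ → Set Ω := fun k =>
    F ∩ {x | ∀ r : ℚ, |r - 0| < 1 / ((k : ℚ) + 1) → A x r ∨ B x r} with hH
  have hradius : ∀ {k l : ℕ}, k ≤ l → (1 : ℚ) / ((l : ℚ) + 1) ≤ 1 / ((k : ℚ) + 1) :=
    fun hkl => Nat.one_div_le_one_div hkl
  have hFa : F = ⋂ k, a k := by
    ext x
    simp only [hF, ha, IntAt, Set.mem_ofPred_eq, Set.mem_iInter]
    push Not
    rfl
  have haanti : Antitone a := fun k l hkl x ⟨r, hr, hx⟩ => ⟨r, hr.trans_le (hradius hkl), hx⟩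
  have hHmono : Monotone H := fun k l hkl x hx =>
    ⟨hx.1, fun r hr => hx.2 r (hr.trans_le (hradius hkl))⟩
  have hFm : MeasurableSet[m₁] F := (measurableSet_intAt hA 0).compl
  have ham : ∀ k, MeasurableSet[m₁] (a k) := by
    intro k
    simp only [ha, Set.ofPred_exists]
    refine MeasurableSet.iUnion fun r => ?_
    by_cases hr : |r - 0| < 1 / ((k : ℚ) + 1)
    · simpa only [hr, true_and] using! (hA r).compl
    · simp only [hr, false_and]
      exact MeasurableSet.const _
  have hBm : ∀ t, MeasurableSet[m₂] {x | IntAt (B x) t} := measurableSet_intAt hB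
  have hHa : ∀ k, μ (H k) ≤ c * μ (a k) := by
    intro k
    set e : ℕ → ℚ := ⇑(Denumerable.eqv ℚ).symm with he
    -- `G i` is the event that the `i`-th rational is a time outside `A` close to `0`.
    set G : ℕ → Set Ω := fun i => {x | |e i - 0| < 1 / ((k : ℚ) + 1) ∧ ¬ A x (e i)} with hG
    have hGm : ∀ i, MeasurableSet[m₁] (G i) := by
      intro i
      simp only [hG]
      by_cases hr : |e i - 0| < 1 / ((k : ℚ) + 1)
      · simpa only [hr, true_and] using! (hA (e i)).compl
      · simp only [hr, false_and]
        exact MeasurableSet.const _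
    have hdm : ∀ i, MeasurableSet[m₁] (disjointed G i) := fun i =>
      MeasurableSet.disjointed hGm i
    have haG : a k = ⋃ i, G i := by
      ext x
      simp only [ha, hG, Set.mem_ofPred_eq, Set.mem_iUnion]
      exact ⟨fun ⟨r, hr⟩ => ⟨Denumerable.eqv ℚ r, by simpa [he] using hr⟩, fun ⟨i, hi⟩ => ⟨_, hi⟩⟩
    -- The omitted time which comes first in the enumeration is determined by `A`, hence
    -- independent of `B`.
    have hpair : Pairwise fun i j => Disjoint (disjointed G i ∩ {x | IntAt (B x) (e i)})
        (disjointed G j ∩ {x | IntAt (B x) (e j)}) := fun i j hij =>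
      (disjoint_disjointed G hij).mono Set.inter_subset_left Set.inter_subset_left
    have hHT : H k ≤ᵐ[μ] ⋃ i, disjointed G i ∩ {x | IntAt (B x) (e i)} := by
      filter_upwards [hcl] with x hx hxH
      have hxa : x ∈ ⋃ i, disjointed G i := by
        rw [iUnion_disjointed, ← haG]
        have := hxH.1
        rw [hFa] at this
        exact Set.mem_iInter.1 this k
      obtain ⟨i, hi⟩ := Set.mem_iUnion.1 hxa
      obtain ⟨hlt, hnA⟩ : x ∈ G i := disjointed_subset G i hi
      refine Set.mem_iUnion.2 ⟨i, hi, ?_⟩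
      obtain ⟨δ, hδ, h⟩ := intAt_iff.1 (hx (e i) hnA)
      refine intAt_iff.2 ⟨min δ (1 / ((k : ℚ) + 1) - |e i - 0|), lt_min hδ (sub_pos.2 hlt),
        fun r hr => ?_⟩
      have h1 := h r (hr.trans_le (min_le_left _ _))
      have h2 := hr.trans_le (min_le_right _ _)
      have h3 : |r - 0| ≤ |r - e i| + |e i - 0| := abs_sub_le _ _ _
      exact (hxH.2 r (by linarith)).resolve_left h1
    calc μ (H k) ≤ μ (⋃ i, disjointed G i ∩ {x | IntAt (B x) (e i)}) := measure_mono_ae hHT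
      _ = ∑' i, μ (disjointed G i ∩ {x | IntAt (B x) (e i)}) :=
          measure_iUnion hpair fun i => (hm₁ _ (hdm i)).inter (hm₂ _ (hBm _))
      _ = ∑' i, c * μ (disjointed G i) := by
          congr 1
          ext i
          rw [(Indep_iff _ _ μ).1 hind _ _ (hdm i) (hBm _), hst, mul_comm]
      _ = c * μ (a k) := by
          rw [ENNReal.tsum_mul_left, haG, ← iUnion_disjointed,
            measure_iUnion (disjoint_disjointed G) fun i => hm₁ _ (hdm i)]
  have hHF : ∀ k, μ (H k) ≤ c * μ F := by
    intro k
    have hlim := ENNReal.Tendsto.const_mul (a := c)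
      (tendsto_measure_iInter_atTop (μ := μ) (fun l => (hm₁ _ (ham l)).nullMeasurableSet) haanti
        ⟨0, measure_ne_top _ _⟩) (Or.inr (measure_ne_top _ _))
    rw [← hFa] at hlim
    refine ge_of_tendsto hlim ?_
    filter_upwards [Filter.eventually_ge_atTop k] with l hl
    exact (measure_mono (hHmono hl)).trans (hHa l)
  -- The union of the `H k` contains the event that `0` is interior to `B` and not to `A`, and has
  -- no larger probability.
  have hUnion : μ (⋃ k, H k) ≤ c * μ F := by
    rw [hHmono.measure_iUnion]
    exact iSup_le hHF
  have hsub : F ∩ {x | IntAt (B x) 0} ⊆ ⋃ k, H k := by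
    rintro x ⟨hx, k, hk⟩
    exact Set.mem_iUnion.2 ⟨k, hx, fun r hr => Or.inr (hk r hr)⟩
  have hprod : μ (F ∩ {x | IntAt (B x) 0}) = c * μ F := by
    rw [(Indep_iff _ _ μ).1 hind _ _ hFm (hBm 0), mul_comm]
  have hnull : μ ((⋃ k, H k) \ (F ∩ {x | IntAt (B x) 0})) = 0 := by
    rw [measure_sdiff hsub ((hm₁ _ hFm).inter (hm₂ _ (hBm 0))).nullMeasurableSet
      (measure_ne_top _ _), hprod, tsub_eq_zero_of_le hUnion]
  filter_upwards [measure_eq_zero_iff_ae_notMem.1 hnull] with x hx hint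
  by_contra hcon
  rw [not_or] at hcon
  obtain ⟨k, hk⟩ := hint
  exact hx ⟨Set.mem_iUnion.2 ⟨k, hcon.1, hk⟩, fun h => hcon.2 h.2⟩

variable {V : Type*} {B : BranchingTree V} {ℱ : Set V → MeasurableSpace Ω}

theorem ae_intAt_exists (h : IndepField μ B ℱ) {D : V → Set V} {A : V → Ω → ℚ → Prop}
    (S : Finset V) (hA : ∀ v ∈ S, ∀ r, MeasurableSet[ℱ (D v)] {x | A v x r})
    (hD : (S : Set V).PairwiseDisjoint D) (hcl : ∀ v ∈ S, ∀ᵐ x ∂μ, RelClosed (A v x))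
    (hst : ∀ v ∈ S, ∀ t, μ {x | IntAt (A v x) t} = μ {x | IntAt (A v x) 0}) :
    (∀ᵐ x ∂μ, RelClosed fun r => ∃ v ∈ S, A v x r) ∧
      ∀ᵐ x ∂μ, IntAt (fun r => ∃ v ∈ S, A v x r) 0 → ∃ v ∈ S, IntAt (A v x) 0 := by
  classical
  induction S using Finset.induction_on with
  | empty =>
    simp only [Finset.notMem_empty, false_and, exists_false]
    exact ⟨Filter.Eventually.of_forall fun x t _ => ⟨0, fun _ _ => not_false⟩,
      Filter.Eventually.of_forall fun x hx => hx.self⟩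
  | insert v S hv ih =>
    obtain ⟨ih1, ih2⟩ := ih (fun w hw => hA w (Finset.mem_insert_of_mem hw))
      (hD.subset (by simp [Set.subset_insert]))
      (fun w hw => hcl w (Finset.mem_insert_of_mem hw))
      (fun w hw => hst w (Finset.mem_insert_of_mem hw))
    have hv' := Finset.mem_insert_self v S
    simp only [Finset.exists_mem_insert]
    refine ⟨?_, ?_⟩
    · filter_upwards [ih1, hcl v hv'] with x h1 h2 using h2.or h1
    have hdisj : Disjoint (⋃ w ∈ S, D w) (D v) := by
      refine Set.disjoint_iUnion₂_left.2 fun w hw => ?_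
      exact hD (by simp [hw]) (by simp) (by rintro rfl; exact hv hw)
    have hm : ∀ r, MeasurableSet[ℱ (⋃ w ∈ S, D w)] {x | ∃ w ∈ S, A w x r} := by
      intro r
      have : {x | ∃ w ∈ S, A w x r} = ⋃ w ∈ S, {x | A w x r} := by
        ext x
        simp
      rw [this]
      refine Finset.measurableSet_biUnion S fun w hw => ?_
      exact h.mono (Set.subset_biUnion_of_mem (u := D) (Finset.mem_coe.2 hw)) _
        (hA w (Finset.mem_insert_of_mem hw) r)
    filter_upwards [ih2, ae_intAt_or (h.le _) (h.le _) (h.indep _ _ hdisj) hm (hA v hv') ih1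
      (hst v hv')] with x h1 h2 hx
    rcases h2 (hx.mono fun r => Or.symm) with h3 | h3
    · exact Or.inr (h1 h3)
    · exact Or.inl h3

end

section

/-! ### Stationary dynamics on a branching tree -/

variable {V Ω : Type*} [mΩ : MeasurableSpace Ω]

/-- `U v t` is the event that the edge above the vertex `v` is open at time `t`. The law of this
process, observed at rational times, depends only on the level of `v` and is invariant under shifts;
its paths are closed sets with a locally finite boundary. -/
structure IsTreeDynamics (μ : Measure Ω) (B : BranchingTree V) (ℱ : Set V → MeasurableSpace Ω)
    (p : ℕ → ℝ) (U : V → ℝ → Ω → Prop) : Prop where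
  measurable : ∀ v (r : ℚ), MeasurableSet[ℱ {v}] {x | U v r x}
  law : ∀ v w, B.lev v = B.lev w → ∀ r : ℚ,
    IdentDistrib (fun x (t : ℚ) => U v t x) (fun x (t : ℚ) => U w (t + r : ℚ) x) μ μ
  prob : ∀ v, ∀ w ∈ B.ch v, μ.real {x | U w (0 : ℚ) x} = p (B.lev w)
  closed : ∀ᵐ x ∂μ, ∀ v, IsClosed {t : ℝ | U v t x}
  locallyFinite : ∀ᵐ x ∂μ, ∀ v, ∀ a b : ℝ, (frontier {t : ℝ | U v t x} ∩ Set.Icc a b).Finite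

theorem measurable_process {Ω T : Type*} {m : MeasurableSpace Ω} {A : Ω → T → Prop}
    (hA : ∀ r, MeasurableSet[m] {x | A x r}) : Measurable[m] A :=
  @measurable_pi_lambda _ _ _ m _ _ fun r => (@measurableSet_setOfPred _ m _).1 (hA r)

theorem measurableSet_eval {T : Type*} (t : T) : MeasurableSet {η : T → Prop | η t} :=
  measurableSet_setOfPred.2 (measurable_pi_apply t)

theorem indepFun_of_measurable {μ : Measure Ω} {α β : Type*} [MeasurableSpace α]
    [MeasurableSpace β] {m₁ m₂ : MeasurableSpace Ω} (h : Indep m₁ m₂ μ) {X : Ω → α} {Y : Ω → β}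
    (hX : Measurable[m₁] X) (hY : Measurable[m₂] Y) : IndepFun X Y μ :=
  indep_of_indep_of_le_left (indep_of_indep_of_le_right h hY.comap_le) hX.comap_le

variable {μ : Measure Ω} {B : BranchingTree V} {ℱ : Set V → MeasurableSpace Ω} {p : ℕ → ℝ}
  {U : V → ℝ → Ω → Prop}

namespace IsTreeDynamics

theorem measurable_surv (hU : IsTreeDynamics μ B ℱ p U) (h : IndepField μ B ℱ) (m : ℕ) (v : V)
    (r : ℚ) : MeasurableSet[ℱ (B.ProperDesc v)] {x | B.Surv (fun y => U y r x) m v} := by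
  induction m generalizing v with
  | zero =>
    simp only [BranchingTree.Surv]
    exact MeasurableSet.const _
  | succ m ih =>
    have : {x | B.Surv (fun y => U y r x) (m + 1) v} =
        ⋃ w ∈ B.ch v, {x | U w r x} ∩ {x | B.Surv (fun y => U y r x) m w} := by
      ext x
      simp only [BranchingTree.Surv, Set.mem_ofPred_eq, Set.mem_iUnion, Set.mem_inter_iff,
        exists_prop]
    rw [this]
    refine Finset.measurableSet_biUnion _ fun w hw => MeasurableSet.inter ?_ ?_
    · exact h.mono (Set.singleton_subset_iff.2
        (BranchingTree.desc_subset_properDesc hw (BranchingTree.mem_desc_self w))) _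
        (hU.measurable w r)
    · exact h.mono ((BranchingTree.properDesc_subset_desc w).trans
        (BranchingTree.desc_subset_properDesc hw)) _ (ih w)

theorem measurable_survives (hU : IsTreeDynamics μ B ℱ p U) (h : IndepField μ B ℱ) (v : V)
    (r : ℚ) : MeasurableSet[ℱ (B.ProperDesc v)] {x | B.Survives (fun y => U y r x) v} := by
  simp only [BranchingTree.Survives, Set.ofPred_forall]
  exact MeasurableSet.iInter fun m => hU.measurable_surv h m v r

/-- The times at which `v` is joined to its descendants `m` levels below form a stationary process
whose law depends only on the level of `v`. -/
theorem law_surv [IsProbabilityMeasure μ] (hU : IsTreeDynamics μ B ℱ p U)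
    (h : IndepField μ B ℱ) {d : ℕ → ℕ} (hd : ∀ v, (B.ch v).card = d (B.lev v)) (m : ℕ) {v w : V}
    (hvw : B.lev v = B.lev w) (r : ℚ) :
    IdentDistrib (fun x (t : ℚ) => B.Surv (fun y => U y t x) m v)
      (fun x (t : ℚ) => B.Surv (fun y => U y (t + r : ℚ) x) m w) μ μ := by
  classical
  induction m generalizing v w with
  | zero =>
    simp only [BranchingTree.Surv]
    exact IdentDistrib.refl aemeasurable_const
  | succ m ih =>
    -- The contribution of one child.
    set A : ℚ → V → Ω → ℚ → Prop := fun r u x t =>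
      U u (t + r : ℚ) x ∧ B.Surv (fun y => U y (t + r : ℚ) x) m u with hA
    have hA0 : ∀ u x t, A 0 u x t ↔ U u t x ∧ B.Surv (fun y => U y t x) m u := by
      intro u x t
      simp [hA]
    have hAm : ∀ r u t, MeasurableSet[ℱ (B.Desc u)] {x | A r u x t} := fun r u t =>
      MeasurableSet.inter
        (h.mono (Set.singleton_subset_iff.2 (BranchingTree.mem_desc_self u)) _
          (hU.measurable u (t + r)))
        (h.mono (BranchingTree.properDesc_subset_desc u) _ (hU.measurable_surv h m u (t + r)))
    have hAlaw : ∀ u u', B.lev u = B.lev u' → IdentDistrib (A 0 u) (A r u') μ μ := by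
      intro u u' huu'
      have hf : Measurable fun η : (ℚ → Prop) × (ℚ → Prop) => fun t => η.1 t ∧ η.2 t :=
        measurable_process fun t => MeasurableSet.inter
          (measurable_fst (measurableSet_eval t)) (measurable_snd (measurableSet_eval t))
      have hind : ∀ (r : ℚ) (u : V), IndepFun (fun x (t : ℚ) => U u (t + r : ℚ) x)
          (fun x (t : ℚ) => B.Surv (fun y => U y (t + r : ℚ) x) m u) μ := fun r u =>
        indepFun_of_measurable (h.indep _ _ (BranchingTree.disjoint_singleton_properDesc u))
          (measurable_process fun t => hU.measurable u (t + r))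
          (measurable_process fun t => hU.measurable_surv h m u (t + r))
      have h1 := hU.law u u' huu' r
      have h2 := ih huu'
      have h3 := (h1.prodMk h2 (by simpa using hind 0 u) (hind r u')).comp hf
      have h4 : A 0 u = fun x (t : ℚ) => U u t x ∧ B.Surv (fun y => U y t x) m u := by
        ext x t
        exact hA0 u x t
      rw [h4]
      exact h3
    -- Children are matched one at a time.
    have key : ∀ S S' : Finset V, S.card = S'.card → (∀ u ∈ S, ∀ u' ∈ S', B.lev u = B.lev u') →
        (∀ u ∈ S, ∀ u' ∈ S, B.lev u = B.lev u') → (∀ u ∈ S', ∀ u' ∈ S', B.lev u = B.lev u') →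
        IdentDistrib (fun x t => ∃ u ∈ S, A 0 u x t) (fun x t => ∃ u ∈ S', A r u x t) μ μ := by
      intro S
      induction S using Finset.induction_on with
      | empty =>
        intro S' hcard _ _ _
        rw [Finset.card_empty, eq_comm, Finset.card_eq_zero] at hcard
        subst hcard
        simp only [Finset.notMem_empty, false_and, exists_false]
        exact IdentDistrib.refl aemeasurable_const
      | insert u S hu ihS =>
        intro S' hcard hSS' hS hS'
        have hne : S'.Nonempty := by
          rw [← Finset.card_pos, ← hcard, Finset.card_insert_of_notMem hu]
          omega
        obtain ⟨u', hu'⟩ := hne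
        obtain ⟨S'', hu'', rfl⟩ : ∃ S'', u' ∉ S'' ∧ insert u' S'' = S' :=
          ⟨S'.erase u', Finset.notMem_erase _ _, Finset.insert_erase hu'⟩
        rw [Finset.card_insert_of_notMem hu, Finset.card_insert_of_notMem hu''] at hcard
        have hrest := ihS S'' (by omega)
          (fun a ha b hb => hSS' a (Finset.mem_insert_of_mem ha) b (Finset.mem_insert_of_mem hb))
          (fun a ha b hb => hS a (Finset.mem_insert_of_mem ha) b (Finset.mem_insert_of_mem hb))
          (fun a ha b hb => hS' a (Finset.mem_insert_of_mem ha) b (Finset.mem_insert_of_mem hb))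
        have hf : Measurable fun η : (ℚ → Prop) × (ℚ → Prop) => fun t => η.1 t ∨ η.2 t :=
          measurable_process fun t => MeasurableSet.union
            (measurable_fst (measurableSet_eval t)) (measurable_snd (measurableSet_eval t))
        have hind : ∀ (r : ℚ) (a : V) (R : Finset V), a ∉ R →
            (∀ b ∈ insert a R, ∀ c ∈ insert a R, B.lev b = B.lev c) →
            IndepFun (A r a) (fun x t => ∃ b ∈ R, A r b x t) μ := by
          intro r a R haR hlev
          have hdisj : Disjoint (B.Desc a) (⋃ b ∈ R, B.Desc b) := by
            refine Set.disjoint_iUnion₂_right.2 fun b hb => ?_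
            exact BranchingTree.disjoint_desc (hlev a (Finset.mem_insert_self _ _) b
              (Finset.mem_insert_of_mem hb)) (by rintro rfl; exact haR hb)
          refine indepFun_of_measurable (h.indep _ _ hdisj)
            (measurable_process fun t => hAm r a t) (measurable_process fun t => ?_)
          have : {x | ∃ b ∈ R, A r b x t} = ⋃ b ∈ R, {x | A r b x t} := by
            ext x
            simp
          rw [this]
          exact Finset.measurableSet_biUnion R fun b hb =>
            h.mono (Set.subset_biUnion_of_mem (u := B.Desc) (Finset.mem_coe.2 hb)) _ (hAm r b t)
        simp only [Finset.exists_mem_insert]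
        exact ((hAlaw u u' (hSS' u (Finset.mem_insert_self _ _) u'
          (Finset.mem_insert_self _ _))).prodMk hrest (hind 0 u S hu hS)
          (hind r u' S'' hu'' hS')).comp hf
    have h1 := key (B.ch v) (B.ch w) (by rw [hd, hd, hvw])
      (fun u hu u' hu' => by rw [B.lev_ch hu, B.lev_ch hu', hvw])
      (fun u hu u' hu' => by rw [B.lev_ch hu, B.lev_ch hu'])
      (fun u hu u' hu' => by rw [B.lev_ch hu, B.lev_ch hu'])
    simp only [hA0] at h1
    exact h1

theorem ae_isClosed_survives (hU : IsTreeDynamics μ B ℱ p U) :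
    ∀ᵐ x ∂μ, ∀ v, IsClosed {t : ℝ | B.Survives (fun y => U y t x) v} := by
  filter_upwards [hU.closed] with x hx v
  have hsurv : ∀ m v, IsClosed {t : ℝ | B.Surv (fun y => U y t x) m v} := by
    intro m
    induction m with
    | zero =>
      intro v
      simp only [BranchingTree.Surv]
      exact isClosed_const
    | succ m ih =>
      intro v
      have : {t : ℝ | B.Surv (fun y => U y t x) (m + 1) v} =
          ⋃ w ∈ B.ch v, {t : ℝ | U w t x} ∩ {t : ℝ | B.Surv (fun y => U y t x) m w} := by
        ext t
        simp only [BranchingTree.Surv, Set.mem_ofPred_eq, Set.mem_iUnion, Set.mem_inter_iff,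
          exists_prop]
      rw [this]
      exact isClosed_biUnion_finset fun w _ => (hx w).inter (ih w)
  simp only [BranchingTree.Survives, Set.ofPred_forall]
  exact isClosed_iInter fun m => hsurv m v

variable [IsProbabilityMeasure μ]

theorem measure_survives (hU : IsTreeDynamics μ B ℱ p U)
    (h : IndepField μ B ℱ) {d : ℕ → ℕ} (hd : ∀ v, (B.ch v).card = d (B.lev v)) {v w : V}
    (hvw : B.lev v = B.lev w) (r : ℚ) (J : Set ℚ) :
    μ {x | ∀ t ∈ J, B.Survives (fun y => U y t x) v} =
      μ {x | ∀ t ∈ J, B.Survives (fun y => U y (t + r : ℚ) x) w} := by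
  have hJ : MeasurableSet {η : ℚ → Prop | ∀ t ∈ J, η t} := by
    simp only [Set.ofPred_forall]
    exact MeasurableSet.iInter fun t => MeasurableSet.iInter fun _ => measurableSet_eval t
  have hlim : ∀ (r : ℚ) (v : V), Filter.Tendsto
      (fun m => μ {x | ∀ t ∈ J, B.Surv (fun y => U y (t + r : ℚ) x) m v}) Filter.atTop
      (nhds (μ {x | ∀ t ∈ J, B.Survives (fun y => U y (t + r : ℚ) x) v})) := by
    intro r v
    have heq : {x | ∀ t ∈ J, B.Survives (fun y => U y (t + r : ℚ) x) v} =
        ⋂ m, {x | ∀ t ∈ J, B.Surv (fun y => U y (t + r : ℚ) x) m v} := by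
      ext x
      simp only [BranchingTree.Survives, Set.mem_ofPred_eq, Set.mem_iInter]
      exact ⟨fun hx m t ht => hx t ht m, fun hx t ht m => hx m t ht⟩
    rw [heq]
    refine tendsto_measure_iInter_atTop (fun m => MeasurableSet.nullMeasurableSet ?_)
      (fun m n hmn x hx t ht => (hx t ht).of_le hmn) ⟨0, measure_ne_top _ _⟩
    simp only [Set.ofPred_forall]
    exact MeasurableSet.iInter fun t => MeasurableSet.iInter fun _ =>
      h.le _ _ (hU.measurable_surv h m v (t + r))
  have h0 := hlim 0 v
  simp only [add_zero] at h0
  refine tendsto_nhds_unique h0 ((hlim r w).congr fun m => ?_)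
  exact ((hU.law_surv h hd m hvw r).measure_mem_eq hJ).symm

theorem measure_intAt_survives (hU : IsTreeDynamics μ B ℱ p U)
    (h : IndepField μ B ℱ) {d : ℕ → ℕ} (hd : ∀ v, (B.ch v).card = d (B.lev v)) {v w : V}
    (hvw : B.lev v = B.lev w) (r : ℚ) :
    μ {x | IntAt (fun t => B.Survives (fun y => U y t x) w) r} =
      μ {x | IntAt (fun t => B.Survives (fun y => U y t x) v) 0} := by
  have hmono : ∀ (r : ℚ) (v : V), Monotone fun k : ℕ =>
      {x | ∀ t ∈ {t : ℚ | |t - 0| < 1 / ((k : ℚ) + 1)},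
        B.Survives (fun y => U y (t + r : ℚ) x) v} := by
    intro r v k l hkl x hx t ht
    rw [Set.mem_ofPred_eq] at ht
    have hle : (1 : ℚ) / ((l : ℚ) + 1) ≤ 1 / ((k : ℚ) + 1) := Nat.one_div_le_one_div hkl
    exact hx t (Set.mem_ofPred_eq ▸ ht.trans_le hle)
  have heq : ∀ (r : ℚ) (v : V), {x | IntAt (fun t => B.Survives (fun y => U y t x) v) r} =
      ⋃ k : ℕ, {x | ∀ t ∈ {t : ℚ | |t - 0| < 1 / ((k : ℚ) + 1)},
        B.Survives (fun y => U y (t + r : ℚ) x) v} := by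
    intro r v
    ext x
    simp only [Set.mem_ofPred_eq, Set.mem_iUnion]
    exact intAt_shift.symm
  rw [heq r w, heq 0 v, (hmono r w).measure_iUnion, (hmono 0 v).measure_iUnion]
  refine iSup_congr fun k => ?_
  rw [← hU.measure_survives h hd hvw r]
  simp only [add_zero]

/-- At a given time, almost surely an edge which is open stays open in a neighbourhood of that time:
the finitely many changes of state in a bounded interval cannot, with a fixed positive probability,
hit each one of infinitely many given times. -/
theorem ae_intAt (hU : IsTreeDynamics μ B ℱ p U) (h : IndepField μ B ℱ) (v : V) (r : ℚ) :
    ∀ᵐ x ∂μ, U v r x → IntAt (fun t : ℚ => U v t x) r := by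
  set N : ℚ → Set Ω := fun r => {x | U v r x ∧ ¬ IntAt (fun t : ℚ => U v t x) r} with hN
  have hNm : ∀ r, MeasurableSet (N r) := fun r =>
    MeasurableSet.inter (h.le _ _ (hU.measurable v r))
      (h.le _ _ (measurableSet_intAt (fun t => hU.measurable v t) r).compl)
  have hN0 : ∀ r, μ (N r) = μ (N 0) := by
    intro r
    have hm : MeasurableSet {η : ℚ → Prop | η 0 ∧ ¬ IntAt η 0} :=
      MeasurableSet.inter (measurableSet_eval 0)
        (measurableSet_intAt (A := fun η : ℚ → Prop => η) measurableSet_eval 0).compl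
    have := (hU.law v v rfl r).measure_mem_eq hm
    refine Eq.trans ?_ this.symm
    congr 1
    ext x
    change _ ↔ U v (0 + r : ℚ) x ∧ ¬ IntAt (fun t : ℚ => U v (t + r : ℚ) x) 0
    rw [intAt_shift (A := fun t : ℚ => U v t x), zero_add]
    rfl
  set τ : ℕ → ℚ := fun i => 1 / ((i : ℚ) + 1) with hτ
  set L : ℕ → Set Ω := fun n => ⋃ i ≥ n, N (τ i) with hL
  have hLanti : Antitone L := fun m n hmn => Set.biUnion_mono (fun i hi => le_trans hmn hi)
    fun _ _ => subset_rfl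
  have hLm : ∀ n, MeasurableSet (L n) := fun n =>
    MeasurableSet.iUnion fun i => MeasurableSet.iUnion fun _ => hNm _
  have hlim := tendsto_measure_iInter_atTop (μ := μ) (fun n => (hLm n).nullMeasurableSet) hLanti
    ⟨0, measure_ne_top _ _⟩
  have hge : μ (N 0) ≤ μ (⋂ n, L n) := by
    refine ge_of_tendsto' hlim fun n => ?_
    rw [← hN0 (τ n)]
    exact measure_mono (Set.subset_biUnion_of_mem (u := fun i => N (τ i)) (le_refl n))
  have hzero : μ (⋂ n, L n) = 0 := by
    refine measure_eq_zero_iff_ae_notMem.2 ?_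
    filter_upwards [hU.locallyFinite] with x hx hxL
    have hinj : Function.Injective fun i : ℕ => ((τ i : ℚ) : ℝ) := by
      intro i j hij
      have hij : τ i = τ j := Rat.cast_injective hij
      simp only [hτ, one_div, inv_inj, add_left_inj, Nat.cast_inj] at hij
      exact hij
    have hinf : {i | x ∈ N (τ i)}.Infinite := by
      refine Nat.frequently_atTop_iff_infinite.1 (Filter.frequently_atTop.2 fun n => ?_)
      simpa only [hL, Set.mem_iUnion₂, exists_prop] using Set.mem_iInter.1 hxL n
    refine (hinf.image hinj.injOn) ((hx v 0 1).subset ?_)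
    rintro _ ⟨i, ⟨hi, hni⟩, rfl⟩
    refine ⟨⟨subset_closure hi, fun hint => hni (intAt_of_mem_interior hint)⟩, ?_, ?_⟩
    · simp only [hτ]
      push_cast
      positivity
    · have : τ i ≤ 1 := by
        simp only [hτ]
        rw [div_le_one (by positivity)]
        have : (0 : ℚ) ≤ i := Nat.cast_nonneg i
        linarith
      change ((τ i : ℚ) : ℝ) ≤ 1
      exact_mod_cast this
  have hr : μ (N r) = 0 := by
    rw [hN0 r]
    exact le_antisymm (hge.trans hzero.le) bot_le
  filter_upwards [measure_eq_zero_iff_ae_notMem.1 hr] with x hx hxU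
  by_contra hcon
  exact hx ⟨hxU, hcon⟩

/-! ### Survival at a time and survival around a time -/

theorem isBranchingEvent_survives (hU : IsTreeDynamics μ B ℱ p U) (h : IndepField μ B ℱ)
    {d : ℕ → ℕ} (hd : ∀ v, (B.ch v).card = d (B.lev v)) :
    ∃ s, IsBranchingEvent μ B ℱ (fun v => {x | U v (0 : ℚ) x})
      (fun v => {x | B.Survives (fun y => U y (0 : ℚ) x) v}) p s := by
  have hfac : Function.FactorsThrough
      (fun v => μ.real {x | B.Survives (fun y => U y (0 : ℚ) x) v}) B.lev := by
    intro v w hvw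
    have := hU.measure_survives h hd hvw 0 {0}
    simp only [Set.mem_singleton_iff, forall_eq, add_zero] at this
    simp only [measureReal_def, this]
  refine ⟨Function.extend B.lev _ 0, fun v => hU.measurable v 0,
    fun v => hU.measurable_survives h v 0, hU.prob, fun v => (hfac.extend_apply 0 v).symm,
    fun v => Filter.Eventually.of_forall fun x => ?_⟩
  exact BranchingTree.survives_iff

/-- Being connected to infinity throughout a neighbourhood of time `0` is inherited from a single
child, since the union over the children of the times at which they percolate has `0` in its
interior only if one of these sets does. -/
theorem isBranchingEvent_intAt (hU : IsTreeDynamics μ B ℱ p U) (h : IndepField μ B ℱ)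
    {d : ℕ → ℕ} (hd : ∀ v, (B.ch v).card = d (B.lev v)) :
    ∃ q, IsBranchingEvent μ B ℱ (fun v => {x | U v (0 : ℚ) x})
      (fun v => {x | IntAt (fun t => B.Survives (fun y => U y t x) v) 0}) p q := by
  have hfac : Function.FactorsThrough
      (fun v => μ.real {x | IntAt (fun t => B.Survives (fun y => U y t x) v) 0}) B.lev := by
    intro v w hvw
    simp only [measureReal_def, hU.measure_intAt_survives h hd hvw 0]
  refine ⟨Function.extend B.lev _ 0, fun v => hU.measurable v 0,
    fun v => measurableSet_intAt (fun t => hU.measurable_survives h v t) 0, hU.prob,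
    fun v => (hfac.extend_apply 0 v).symm, fun v => ?_⟩
  set A : V → Ω → ℚ → Prop := fun w x t => U w t x ∧ B.Survives (fun y => U y t x) w with hA
  have hAm : ∀ w t, MeasurableSet[ℱ (B.Desc w)] {x | A w x t} := fun w t =>
    MeasurableSet.inter
      (h.mono (Set.singleton_subset_iff.2 (BranchingTree.mem_desc_self w)) _ (hU.measurable w t))
      (h.mono (BranchingTree.properDesc_subset_desc w) _ (hU.measurable_survives h w t))
  have hcl : ∀ w, ∀ᵐ x ∂μ, RelClosed (A w x) := by
    intro w
    filter_upwards [hU.closed, hU.ae_isClosed_survives] with x h1 h2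
    exact relClosed_of_isClosed ((h1 w).inter (h2 w))
  have hst : ∀ w t, μ {x | IntAt (A w x) t} = μ {x | IntAt (A w x) 0} := by
    intro w t
    have hprod : ∀ t, μ {x | IntAt (A w x) t} = μ {x | IntAt (fun r : ℚ => U w r x) t} *
        μ {x | IntAt (fun r => B.Survives (fun y => U y r x) w) t} := by
      intro t
      rw [← (Indep_iff _ _ μ).1 (h.indep _ _ (BranchingTree.disjoint_singleton_properDesc w)) _ _
        (measurableSet_intAt (fun r => hU.measurable w r) t)
        (measurableSet_intAt (fun r => hU.measurable_survives h w r) t)]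
      congr 1
      ext x
      exact intAt_and
    have hUst : μ {x | IntAt (fun r : ℚ => U w r x) t} =
        μ {x | IntAt (fun r : ℚ => U w r x) 0} := by
      have hm : MeasurableSet {η : ℚ → Prop | IntAt η 0} :=
        measurableSet_intAt (A := fun η : ℚ → Prop => η) measurableSet_eval 0
      refine Eq.trans ?_ ((hU.law w w rfl t).measure_mem_eq hm).symm
      congr 1
      ext x
      exact (intAt_shift (A := fun r : ℚ => U w r x)).symm
    rw [hprod, hprod, hUst, hU.measure_intAt_survives h hd rfl t]
  have hunion := (ae_intAt_exists h (B.ch v) (fun w _ => hAm w)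
    (fun u hu w hw hne => BranchingTree.disjoint_desc (by rw [B.lev_ch hu, B.lev_ch hw]) hne)
    (fun w _ => hcl w) (fun w _ => hst w)).2
  have hopen : ∀ᵐ x ∂μ, ∀ w ∈ B.ch v, U w (0 : ℚ) x → IntAt (fun t : ℚ => U w t x) 0 :=
    (Finset.eventually_all _).2 fun w _ => hU.ae_intAt h w 0
  filter_upwards [hunion, hopen] with x h1 h2
  constructor
  · intro hx
    obtain ⟨w, hw, hint⟩ := h1 (hx.mono fun r hr => BranchingTree.survives_iff.1 hr)
    exact ⟨w, hw, hint.self.1, (intAt_and.1 hint).2⟩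
  · rintro ⟨w, hw, hopen, hint⟩
    exact (intAt_and.2 ⟨h2 w hw hopen, hint⟩).mono fun r hr =>
      BranchingTree.survives_iff.2 ⟨w, hw, hr⟩

/-- If the root, with positive probability, is connected to infinity at time `0` but not throughout
a neighbourhood of `0`, then almost surely no vertex is connected to infinity throughout an open
interval. -/
theorem ae_forall_not_intAt [Countable V] (hU : IsTreeDynamics μ B ℱ p U)
    (h : IndepField μ B ℱ) {d : ℕ → ℕ} (hd : ∀ v, (B.ch v).card = d (B.lev v)) {ρ : V}
    (hρ : B.lev ρ = 0) {b : ℝ} (hb : b < 1) (hp : ∀ n, 0 < p (n + 1) ∧ p (n + 1) ≤ b)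
    (hpos : μ {x | B.Survives (fun y => U y (0 : ℚ) x) ρ ∧
      ¬ IntAt (fun t => B.Survives (fun y => U y t x) ρ) 0} ≠ 0) :
    ∀ᵐ x ∂μ, ∀ v r, ¬ IntAt (fun t => B.Survives (fun y => U y t x) v) r := by
  obtain ⟨s, hs⟩ := hU.isBranchingEvent_survives h hd
  obtain ⟨q, hq⟩ := hU.isBranchingEvent_intAt h hd
  have hsub : ∀ v, {x | IntAt (fun t => B.Survives (fun y => U y t x) v) 0} ⊆
      {x | B.Survives (fun y => U y (0 : ℚ) x) v} := fun v x hx => IntAt.self hx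
  have hlt : q 0 < s 0 := by
    rw [← hρ, ← hq.prob, ← hs.prob]
    have hdiff := measureReal_sdiff (hsub ρ) (h.le _ _ (hq.measurable ρ)) (μ := μ)
    have : 0 < μ.real ({x | B.Survives (fun y => U y (0 : ℚ) x) ρ} \
        {x | IntAt (fun t => B.Survives (fun y => U y t x) ρ) 0}) :=
      ENNReal.toReal_pos hpos (measure_ne_top _ _)
    linarith
  have hq0 : 0 ≤ q 0 := by
    rw [← hρ, ← hq.prob]
    exact measureReal_nonneg
  have hlev := hs.exists_lev h hρ (hq0.trans_lt hlt)
  have hsrec : ∀ n, s n = 1 - (1 - p (n + 1) * s (n + 1)) ^ d n := by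
    intro n
    obtain ⟨v, hv, -⟩ := hlev n
    have := hs.recursion h v
    rwa [hd, hv] at this
  have hqrec : ∀ n, q n = 1 - (1 - p (n + 1) * q (n + 1)) ^ d n := by
    intro n
    obtain ⟨v, hv, -⟩ := hlev n
    have := hq.recursion h v
    rwa [hd, hv] at this
  have hqs : ∀ n, q n ≤ s n := by
    intro n
    obtain ⟨v, hv, -⟩ := hlev n
    rw [← hv, ← hq.prob v, ← hs.prob v]
    exact measureReal_mono (hsub v)
  have hs1 : ∀ n, s n ≤ 1 := by
    intro n
    obtain ⟨v, hv, -⟩ := hlev n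
    rw [← hv, ← hs.prob v]
    exact measureReal_le_one
  have hqnonneg : ∀ n, 0 ≤ q n := by
    intro n
    obtain ⟨v, hv, -⟩ := hlev n
    rw [← hv, ← hq.prob v]
    exact measureReal_nonneg
  have hd0 : ∀ n, d n ≠ 0 := by
    intro n hn
    obtain ⟨v, hv, hsn⟩ := hlev n
    have := hsrec n
    rw [hn, pow_zero, sub_self] at this
    exact hsn.ne' this
  have hq_zero : q 0 = 0 := by
    by_contra hne
    have hqpos : 0 < q 0 := lt_of_le_of_ne hq0 (Ne.symm hne)
    refine hlt.ne (recursion_unique hd0 (fun n => ⟨(hp n).1, (hp n).2.trans_lt hb⟩)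
      (fun n => ?_) hqs hs1 hqrec hsrec (hq.mean_unbounded h hρ hd hqpos hb hp))
    exact (hq.exists_lev h hρ hqpos n).choose_spec.2
  have hqall : ∀ n, q n = 0 := by
    intro n
    induction n with
    | zero => exact hq_zero
    | succ n ih =>
      have hrec := hqrec n
      rw [ih] at hrec
      by_contra hne
      have hqn : 0 < q (n + 1) := lt_of_le_of_ne (hqnonneg _) (Ne.symm hne)
      have hle : p (n + 1) * q (n + 1) ≤ 1 := by
        calc p (n + 1) * q (n + 1) ≤ p (n + 1) * 1 :=
              mul_le_mul_of_nonneg_left ((hqs _).trans (hs1 _)) (hp n).1.le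
          _ ≤ 1 := by linarith [(hp n).2]
      have := one_sub_pow_pos (hd0 n) (mul_pos (hp n).1 hqn) hle
      linarith
  refine ae_all_iff.2 fun v => ae_all_iff.2 fun r => ?_
  suffices hnull : μ {x | IntAt (fun t => B.Survives (fun y => U y t x) v) r} = 0 from
    measure_eq_zero_iff_ae_notMem.1 hnull
  have h1 := hU.measure_intAt_survives h hd (v := v) rfl r
  have h2 := hq.prob v
  rw [hqall, measureReal_def, ENNReal.toReal_eq_zero_iff] at h2
  rw [h1]
  exact h2.resolve_right (measure_ne_top _ _)

end IsTreeDynamics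

end

section

/-! ### The branching tree of a rooted graph tree -/

variable {V : Type*} {T : SimpleGraph V} {ρ : V}

theorem IsSphericallySymmetricTree.finite_children (hT : IsSphericallySymmetricTree T ρ) (v : V) :
    (children T ρ v).Finite :=
  (hT.locallyFinite v).subset fun _ h => h.1

theorem IsSphericallySymmetricTree.eq_of_mem_children (hT : IsSphericallySymmetricTree T ρ)
    {u v w : V} (hu : w ∈ children T ρ u) (hv : w ∈ children T ρ v) : u = v := by
  -- A geodesic from `ρ` to a parent of `w` extends to a geodesic to `w`, and paths are unique.
  have key : ∀ u, w ∈ children T ρ u →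
      ∃ P : T.Walk ρ w, P.IsPath ∧ P.penultimate = u := by
    intro u hu
    obtain ⟨P, hP⟩ := hT.isTree.1.exists_walk_length_eq_dist ρ u
    refine ⟨P.concat hu.1, SimpleGraph.Walk.isPath_of_length_eq_dist _ ?_, by simp⟩
    rw [SimpleGraph.Walk.length_concat, hP, hu.2]
  obtain ⟨P, hP, rfl⟩ := key u hu
  obtain ⟨P', hP', rfl⟩ := key v hv
  have := (hT.isTree.2.subsingleton_path ρ w).elim ⟨P, hP⟩ ⟨P', hP'⟩
  rw [Subtype.mk.injEq] at this
  rw [this]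

/-- The children and levels of the vertices of a spherically symmetric tree. -/
noncomputable def IsSphericallySymmetricTree.branchingTree
    (hT : IsSphericallySymmetricTree T ρ) : BranchingTree V where
  ch v := (hT.finite_children v).toFinset
  lev := T.dist ρ
  lev_ch h := ((Set.Finite.mem_toFinset _).1 h).2
  parent_unique hu hv :=
    hT.eq_of_mem_children ((Set.Finite.mem_toFinset _).1 hu) ((Set.Finite.mem_toFinset _).1 hv)

variable (hT : IsSphericallySymmetricTree T ρ)

theorem mem_branchingTree_ch {v w : V} : w ∈ hT.branchingTree.ch v ↔ w ∈ children T ρ v :=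
  Set.Finite.mem_toFinset _

theorem exists_card_ch_eq :
    ∃ d : ℕ → ℕ, ∀ v, (hT.branchingTree.ch v).card = d (hT.branchingTree.lev v) := by
  have hfac : Function.FactorsThrough (fun v => (children T ρ v).ncard) (T.dist ρ) :=
    fun u v huv => hT.symmetric u v huv
  refine ⟨Function.extend (T.dist ρ) (fun v => (children T ρ v).ncard) 0, fun v => ?_⟩
  refine Eq.trans ?_ (hfac.extend_apply 0 v).symm
  exact (Set.ncard_eq_toFinset_card _ _).symm

theorem IsSphericallySymmetricTree.exists_parent (hT : IsSphericallySymmetricTree T ρ) {w : V}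
    (hw : T.dist ρ w ≠ 0) : ∃ v, w ∈ children T ρ v := by
  obtain ⟨P, hP⟩ := hT.isTree.1.exists_walk_length_eq_dist w ρ
  cases P with
  | nil => exact absurd SimpleGraph.dist_self hw
  | cons hadj P =>
    rename_i v
    refine ⟨v, hadj.symm, ?_⟩
    have h1 : T.dist v ρ ≤ P.length := SimpleGraph.dist_le P
    rw [SimpleGraph.Walk.length_cons, SimpleGraph.dist_comm] at hP
    rw [SimpleGraph.dist_comm] at h1
    have h2 := hT.isTree.dist_eq_dist_add_one_of_adj ρ hadj
    omega

theorem IsSphericallySymmetricTree.countable (hT : IsSphericallySymmetricTree T ρ) :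
    Countable V := by
  have hall : ∀ n, ∀ v, T.dist ρ v = n → v ∈ hT.branchingTree.gen ρ (fun _ => True) n := by
    intro n
    induction n with
    | zero =>
      intro v hv
      rw [hT.isTree.1.dist_eq_zero_iff] at hv
      exact Finset.mem_singleton.2 hv.symm
    | succ n ih =>
      intro v hv
      obtain ⟨u, hu⟩ := hT.exists_parent (w := v) (by omega)
      have := hu.2
      exact BranchingTree.mem_gen_succ.2
        ⟨⟨u, ih u (by omega), (mem_branchingTree_ch hT).2 hu⟩, trivial⟩
  refine Set.countable_univ_iff.1 ((Set.countable_iUnion fun n : ℕ =>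
    (hT.branchingTree.gen ρ (fun _ => True) n).countable_toSet).mono fun v _ => ?_)
  exact Set.mem_iUnion.2 ⟨_, hall _ v rfl⟩

/-- The edge `e` joins the vertex `y` to its parent. -/
def IsUpEdge (T : SimpleGraph V) (ρ : V) (e : T.edgeSet) (y : V) : Prop :=
  ∃ v, y ∈ children T ρ v ∧ e.1 = s(v, y)

variable {hT}

theorem IsUpEdge.left_unique (hT : IsSphericallySymmetricTree T ρ) {e e' : T.edgeSet} {y : V}
    (h : IsUpEdge T ρ e y) (h' : IsUpEdge T ρ e' y) : e = e' := by
  obtain ⟨v, hv, he⟩ := h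
  obtain ⟨v', hv', he'⟩ := h'
  obtain rfl := hT.eq_of_mem_children hv hv'
  exact Subtype.ext (he.trans he'.symm)

theorem IsUpEdge.right_unique {e : T.edgeSet} {y y' : V}
    (h : IsUpEdge T ρ e y) (h' : IsUpEdge T ρ e y') : y = y' := by
  obtain ⟨v, hv, he⟩ := h
  obtain ⟨v', hv', he'⟩ := h'
  have h1 := hv.2
  have h2 := hv'.2
  rcases Sym2.eq_iff.1 (he.symm.trans he') with ⟨-, h⟩ | ⟨ha, hb⟩
  · exact h
  · subst ha hb
    omega

theorem IsUpEdge.edgeLevel {e : T.edgeSet} {y : V} (h : IsUpEdge T ρ e y) :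
    edgeLevel T ρ e = T.dist ρ y := by
  obtain ⟨v, hv, he⟩ := h
  have hdist := hv.2
  rw [show e = ⟨s(v, y), hv.1⟩ from Subtype.ext he, edgeLevel_mk]
  omega

theorem IsUpEdge.dist_ne_zero {e : T.edgeSet} {y : V} (h : IsUpEdge T ρ e y) :
    T.dist ρ y ≠ 0 := by
  obtain ⟨v, hv, -⟩ := h
  have := hv.2
  omega

theorem exists_isUpEdge {v w : V} (h : w ∈ children T ρ v) : ∃ e, IsUpEdge T ρ e w :=
  ⟨⟨s(v, w), h.1⟩, v, h, rfl⟩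

/-- The edge above the vertex `y` is open in the configuration `η`; this is false for the root. -/
def UpOpen (T : SimpleGraph V) (ρ : V) (η : T.edgeSet → Bool) (y : V) : Prop :=
  ∃ e, IsUpEdge T ρ e y ∧ η e = true

theorem IsUpEdge.upOpen_iff (hT : IsSphericallySymmetricTree T ρ) {e : T.edgeSet} {y : V}
    (h : IsUpEdge T ρ e y) {η : T.edgeSet → Bool} : UpOpen T ρ η y ↔ η e = true := by
  refine ⟨fun ⟨e', he', hη⟩ => ?_, fun hη => ⟨e, h, hη⟩⟩
  rwa [h.left_unique hT he']

theorem upOpen_iff_adj (hT : IsSphericallySymmetricTree T ρ) {v w : V} (h : w ∈ children T ρ v)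
    {η : T.edgeSet → Bool} : UpOpen T ρ η w ↔ (openSubgraph T η).Adj v w := by
  have he : IsUpEdge T ρ ⟨s(v, w), h.1⟩ w := ⟨v, h, rfl⟩
  rw [he.upOpen_iff hT]
  exact ⟨fun hη => ⟨h.1, hη⟩, fun ⟨_, hη⟩ => hη⟩

variable (hT) (η : T.edgeSet → Bool)

theorem reached_subset_cluster (u : V) :
    hT.branchingTree.Reached (UpOpen T ρ η) u ⊆ cluster T η u := by
  intro w hw
  induction hw with
  | refl => exact SimpleGraph.Reachable.refl u
  | tail _ h ih =>
    have hch := (mem_branchingTree_ch hT).1 h.1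
    exact SimpleGraph.Reachable.trans ih ((upOpen_iff_adj hT hch).1 h.2).reachable

/-- The vertices of a cluster are reached by going down from its vertex nearest to the root. -/
theorem cluster_subset_reached {u : V} (hu : ∀ w ∈ cluster T η u, T.dist ρ u ≤ T.dist ρ w) :
    cluster T η u ⊆ hT.branchingTree.Reached (UpOpen T ρ η) u := by
  intro w hw
  have hw' := (SimpleGraph.reachable_iff_reflTransGen u w).1 hw
  clear hw
  induction hw' with
  | refl => exact Relation.ReflTransGen.refl
  | tail hx hadj ih =>
    rename_i x y
    have hTadj : T.Adj x y := hadj.1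
    rcases hT.isTree.dist_eq_dist_add_one_of_adj ρ hTadj with h | h
    · have hch : x ∈ children T ρ y := ⟨hTadj.symm, h⟩
      rcases Relation.ReflTransGen.cases_tail ih with rfl | ⟨z, hz, hzx, -⟩
      · have := hu y ((SimpleGraph.reachable_iff_reflTransGen _ _).2 (hx.tail hadj))
        omega
      · rwa [← hT.eq_of_mem_children ((mem_branchingTree_ch hT).1 hzx) hch]
    · have hch : y ∈ children T ρ x := ⟨hTadj, h⟩
      exact ih.tail ⟨(mem_branchingTree_ch hT).2 hch, (upOpen_iff_adj hT hch).2 hadj⟩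

theorem cluster_root_infinite_iff :
    (cluster T η ρ).Infinite ↔ hT.branchingTree.Survives (UpOpen T ρ η) ρ := by
  rw [← BranchingTree.reached_infinite_iff, (reached_subset_cluster hT η ρ).antisymm
    (cluster_subset_reached hT η fun w _ => by rw [SimpleGraph.dist_self]; exact Nat.zero_le _)]

theorem exists_survives_of_cluster_infinite {v : V} (h : (cluster T η v).Infinite) :
    ∃ u, hT.branchingTree.Survives (UpOpen T ρ η) u := by
  obtain ⟨u, hu, hmin⟩ := (InvImage.wf (T.dist ρ) wellFounded_lt).has_min (cluster T η v)
    ⟨v, SimpleGraph.Reachable.refl v⟩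
  have heq : cluster T η u = cluster T η v := by
    ext w
    exact ⟨fun hw => SimpleGraph.Reachable.trans hu hw,
      fun hw => (SimpleGraph.Reachable.symm hu).trans hw⟩
  refine ⟨u, BranchingTree.reached_infinite_iff.1 (Set.Infinite.mono
    (cluster_subset_reached hT η fun w hw => ?_) (heq ▸ h))⟩
  rw [heq] at hw
  exact not_lt.1 (hmin w hw)

/-! ### Dynamical percolation as a stationary dynamics -/

variable {Ω : Type*} [MeasurableSpace Ω] {μ : Measure Ω}

/-- Two edges with the same parameter have, up to a shift of time, the same law at rational times:
the finite-dimensional distributions involve only the differences of the times. -/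
theorem IsDynamicalPercolation.identDistrib [IsProbabilityMeasure μ] {p : T.edgeSet → ℝ}
    {ω : ℝ → T.edgeSet → Ω → Bool}
    (hω : IsDynamicalPercolation μ T p ω) {e e' : T.edgeSet} (hp : p e = p e') (r : ℚ) :
    IdentDistrib (fun x (t : ℚ) => ω t e x) (fun x (t : ℚ) => ω (t + r : ℚ) e' x) μ μ := by
  have hm : ∀ e (r : ℚ), Measurable fun x (t : ℚ) => ω (t + r : ℚ) e x := fun e r =>
    measurable_pi_lambda _ fun t => hω.measurable _ e
  have hm0 : ∀ e, Measurable fun x (t : ℚ) => ω t e x := fun e =>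
    measurable_pi_lambda _ fun t => hω.measurable _ e
  refine ⟨(hm0 e).aemeasurable, (hm e' r).aemeasurable, ?_⟩
  have hfin : ∀ (I : Finset ℚ) (s : I → Bool), μ {x | ∀ i : I, ω (i : ℚ) e x = s i} =
      μ {x | ∀ i : I, ω ((i : ℚ) + r : ℚ) e' x = s i} := by
    intro I s
    rcases I.eq_empty_or_nonempty with rfl | hne
    · simp
    obtain ⟨n, hn⟩ := Nat.exists_eq_succ_of_ne_zero (Finset.card_pos.2 hne).ne'
    set τ := I.orderEmbOfFin hn with hτ
    have hτmem : ∀ k, τ k ∈ I := fun k => Finset.orderEmbOfFin_mem I hn k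
    have hτsurj : ∀ i : I, ∃ k, τ k = i := fun i => by
      have : (i : ℚ) ∈ Set.range τ := by
        rw [hτ, Finset.range_orderEmbOfFin]
        exact i.2
      exact this
    have hset : ∀ (e : T.edgeSet) (r : ℚ), {x | ∀ i : I, ω ((i : ℚ) + r : ℚ) e x = s i} =
        {x | ∀ k, ω ((τ k + r : ℚ) : ℝ) e x = s ⟨τ k, hτmem k⟩} := by
      intro e r
      ext x
      refine ⟨fun hx k => hx ⟨τ k, hτmem k⟩, fun hx i => ?_⟩
      obtain ⟨k, hk⟩ := hτsurj i
      have := hx k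
      simpa only [hk] using this
    have hmk : ∀ (e : T.edgeSet) (r : ℚ), StrictMono fun k => ((τ k + r : ℚ) : ℝ) := by
      intro e r k l hkl
      have : τ k < τ l := τ.strictMono hkl
      exact Rat.cast_lt.2 (by linarith)
    have h0 := hset e 0
    simp only [add_zero] at h0
    have hmk0 := hmk e 0
    simp only [add_zero] at hmk0
    rw [h0, hset e' r, hω.markov e n _ hmk0, hω.markov e' n _ (hmk e' r), hp]
    congr 3
    ext k
    congr 1
    push_cast
    ring
  have hproj : ∀ I : Finset ℚ, (μ.map fun x (t : ℚ) => ω t e x).map I.restrict =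
      (μ.map fun x (t : ℚ) => ω (t + r : ℚ) e' x).map I.restrict := by
    intro I
    have hres : Measurable (I.restrict : (ℚ → Bool) → I → Bool) := Finset.measurable_restrict I
    rw [Measure.map_map hres (hm0 e), Measure.map_map hres (hm e' r)]
    refine Measure.ext_of_singleton fun s => ?_
    rw [Measure.map_apply (hres.comp (hm0 e)) (measurableSet_singleton s),
      Measure.map_apply (hres.comp (hm e' r)) (measurableSet_singleton s)]
    have := hfin I s
    convert this using 2
    · ext x
      simp [funext_iff, Finset.restrict]
    · ext x
      simp [funext_iff, Finset.restrict]
  have : IsProbabilityMeasure (μ.map fun x (t : ℚ) => ω (t + r : ℚ) e' x) :=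
    Measure.isProbabilityMeasure_map (hm e' r).aemeasurable
  have hfinite : ∀ I : Finset ℚ, IsFiniteMeasure
      ((μ.map fun x (t : ℚ) => ω (t + r : ℚ) e' x).map I.restrict) := fun I => inferInstance
  exact IsProjectiveLimit.unique
    (P := fun I => (μ.map fun x (t : ℚ) => ω (t + r : ℚ) e' x).map I.restrict)
    (fun I => hproj I) (fun I => rfl)

/-- The information carried by the edges above the vertices of `S`. -/
abbrev edgeField (ρ : V) (ω : ℝ → T.edgeSet → Ω → Bool) (S : Set V) : MeasurableSpace Ω :=
  ⨆ e ∈ {e : T.edgeSet | ∃ y ∈ S, IsUpEdge T ρ e y},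
    MeasurableSpace.comap (fun x t => ω t e x) inferInstance

theorem IsDynamicalPercolation.indepField {p : T.edgeSet → ℝ} {ω : ℝ → T.edgeSet → Ω → Bool}
    (hω : IsDynamicalPercolation μ T p ω) :
    IndepField μ hT.branchingTree (edgeField ρ ω) where
  mono := fun S S' hSS' => biSup_mono fun e ⟨y, hy, he⟩ => ⟨y, hSS' hy, he⟩
  le := fun S => iSup₂_le fun e _ =>
    (measurable_pi_lambda _ fun t => hω.measurable t e).comap_le
  indep := by
    intro S S' hSS'
    refine indep_iSup_of_disjoint
      (fun e => (measurable_pi_lambda _ fun t => hω.measurable t e).comap_le) hω.indep ?_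
    refine Set.disjoint_left.2 ?_
    rintro e ⟨y, hy, he⟩ ⟨y', hy', he'⟩
    obtain rfl := he.right_unique he'
    exact Set.disjoint_left.1 hSS' hy hy'
  le_iSup := by
    refine iSup₂_le fun e ⟨y, _, he⟩ => le_iSup_of_le (T.dist ρ y) ?_
    exact le_iSup₂_of_le (f := fun e (_ : e ∈ {e : T.edgeSet | ∃ z ∈ {z | hT.branchingTree.lev z ≤
      T.dist ρ y}, IsUpEdge T ρ e z}) => MeasurableSpace.comap (fun x t => ω t e x) inferInstance)
      e ⟨y, le_refl (T.dist ρ y), he⟩ le_rfl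

theorem IsDynamicalPercolation.isTreeDynamics [IsProbabilityMeasure μ] {p : ℕ → ℝ}
    (hp : ∀ n, 0 ≤ p (n + 1))
    {ω : ℝ → T.edgeSet → Ω → Bool}
    (hω : IsDynamicalPercolation μ T (fun e => p (edgeLevel T ρ e)) ω) :
    IsTreeDynamics μ hT.branchingTree (edgeField ρ ω) p
      (fun v t x => UpOpen T ρ (fun e => ω t e x) v) where
  measurable := by
    intro v r
    by_cases hv : ∃ e, IsUpEdge T ρ e v
    · obtain ⟨e, he⟩ := hv
      simp only [he.upOpen_iff hT]
      have hle : MeasurableSpace.comap (fun x t => ω t e x) inferInstance ≤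
          edgeField ρ ω {v} := le_iSup₂_of_le
        (f := fun e (_ : e ∈ {e : T.edgeSet | ∃ z ∈ ({v} : Set V), IsUpEdge T ρ e z}) =>
          MeasurableSpace.comap (fun x t => ω t e x) inferInstance) e ⟨v, rfl, he⟩ le_rfl
      refine hle _ ⟨{f : ℝ → Bool | f r = true}, ?_, rfl⟩
      exact (measurable_pi_apply (r : ℝ) : Measurable fun f : ℝ → Bool => f r)
        (measurableSet_singleton true)
    · have : ∀ x, ¬ UpOpen T ρ (fun e => ω r e x) v := fun x ⟨e, he, _⟩ => hv ⟨e, he⟩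
      simp only [this]
      exact MeasurableSet.const _
  law := by
    intro v w hvw r
    change T.dist ρ v = T.dist ρ w at hvw
    by_cases hv : T.dist ρ v = 0
    · have hno : ∀ u, T.dist ρ u = 0 → ∀ η, ¬ UpOpen T ρ η u :=
        fun u hu η ⟨e, he, _⟩ => he.dist_ne_zero hu
      simp only [hno v hv, hno w (hvw ▸ hv)]
      exact IdentDistrib.refl aemeasurable_const
    · obtain ⟨u, hu⟩ := hT.exists_parent hv
      obtain ⟨u', hu'⟩ := hT.exists_parent (hvw ▸ hv)
      obtain ⟨e, he⟩ := exists_isUpEdge hu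
      obtain ⟨e', he'⟩ := exists_isUpEdge hu'
      simp only [he.upOpen_iff hT, he'.upOpen_iff hT]
      have hf : Measurable fun (f : ℚ → Bool) (t : ℚ) => f t = true :=
        measurable_process fun t =>
          (measurable_pi_apply t : Measurable fun f : ℚ → Bool => f t)
            (measurableSet_singleton true)
      exact (hω.identDistrib (by rw [he.edgeLevel, he'.edgeLevel, hvw]) r).comp hf
  prob := by
    intro v w hw
    obtain ⟨e, he⟩ := exists_isUpEdge ((mem_branchingTree_ch hT).1 hw)
    have hmk := hω.markov e 0 (fun _ => 0) (fun i j hij => by omega) (fun _ => true)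
    simp only [forall_const, Finset.univ_eq_empty, Finset.prod_empty, mul_one, stationaryLaw] at hmk
    simp only [he.upOpen_iff hT, Rat.cast_zero, measureReal_def]
    rw [hmk, he.edgeLevel]
    refine ENNReal.toReal_ofReal ?_
    change 0 ≤ p (hT.branchingTree.lev w)
    rw [hT.branchingTree.lev_ch hw]
    exact hp _
  closed := by
    filter_upwards [hω.paths] with x hx v
    by_cases hv : ∃ e, IsUpEdge T ρ e v
    · obtain ⟨e, he⟩ := hv
      simp only [he.upOpen_iff hT]
      rw [← (hx e).1]
      exact isClosed_closure
    · have : ∀ t, ¬ UpOpen T ρ (fun e => ω t e x) v := fun x ⟨e, he, _⟩ => hv ⟨e, he⟩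
      simp only [this]
      exact isClosed_const
  locallyFinite := by
    filter_upwards [hω.paths] with x hx v a b
    by_cases hv : ∃ e, IsUpEdge T ρ e v
    · obtain ⟨e, he⟩ := hv
      simp only [he.upOpen_iff hT]
      exact (hx e).2 a b
    · have : {t | UpOpen T ρ (fun e => ω t e x) v} = ∅ :=
        Set.eq_empty_of_forall_notMem fun x ⟨e, he, _⟩ => hv ⟨e, he⟩
      rw [this]
      simp

/-! ### Interiors of closed sets of times -/

theorem mem_interior_of_intAt {K : Set ℝ} (hK : IsClosed K) {t : ℚ}
    (h : IntAt (fun r : ℚ => (r : ℝ) ∈ K) t) : (t : ℝ) ∈ interior K := by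
  obtain ⟨ε, hε, h⟩ := intAt_iff.1 h
  refine mem_interior.2 ⟨Metric.ball (t : ℝ) ε, ?_, Metric.isOpen_ball,
    Metric.mem_ball_self (by exact_mod_cast hε)⟩
  refine ((Rat.denseRange_cast (𝕜 := ℝ)).open_subset_closure_inter Metric.isOpen_ball).trans
    (closure_minimal ?_ hK)
  rintro _ ⟨hr, r, rfl⟩
  refine h r ?_
  rw [Metric.mem_ball, Real.dist_eq] at hr
  exact_mod_cast hr

theorem interior_eq_empty_of_forall_not_intAt {K : Set ℝ}
    (h : ∀ t : ℚ, ¬ IntAt (fun r : ℚ => (r : ℝ) ∈ K) t) : interior K = ∅ := by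
  by_contra hne
  obtain ⟨_, hr, r, rfl⟩ := (Rat.denseRange_cast (𝕜 := ℝ)).inter_open_nonempty _
    isOpen_interior (Set.nonempty_iff_ne_empty.2 hne)
  exact h r (intAt_of_mem_interior hr)

end

end DynPerc

theorem mainTheorem6 {V Ω : Type*} [MeasurableSpace Ω] (μ : Measure Ω) [IsProbabilityMeasure μ]
    (T : SimpleGraph V) (ρ : V) (hT : DynPerc.IsSphericallySymmetricTree T ρ)
    (p : ℕ → ℝ) (hp : ∃ a b : ℝ, 0 < a ∧ b < 1 ∧ ∀ n, 1 ≤ n → a ≤ p n ∧ p n ≤ b)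
    (ω : ℝ → T.edgeSet → Ω → Bool)
    (hω : DynPerc.IsDynamicalPercolation μ T (fun e => p (DynPerc.edgeLevel T ρ e)) ω)
    (hQ : 0 < μ {x | (0 : ℝ) ∈ frontier (DynPerc.percolationTimes T ω ρ x)}) :
    (∀ᵐ x ∂μ, DynPerc.percolationTimes T ω ρ x = frontier (DynPerc.percolationTimes T ω ρ x)) ∧
      (∀ᵐ x ∂μ, Dense {t : ℝ | ∀ v : V, (DynPerc.cluster T (fun e => ω t e x) v).Finite}) := by
  obtain ⟨a, b, ha, hb, hab⟩ := hp
  have hp : ∀ n, 0 < p (n + 1) ∧ p (n + 1) ≤ b := fun n =>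
    ⟨ha.trans_le (hab (n + 1) (by omega)).1, (hab (n + 1) (by omega)).2⟩
  have hV : Countable V := hT.countable
  set U : V → ℝ → Ω → Prop := fun v t x => DynPerc.UpOpen T ρ (fun e => ω t e x) v with hUdef
  have hU : DynPerc.IsTreeDynamics μ hT.branchingTree (DynPerc.edgeField ρ ω) p U :=
    hω.isTreeDynamics hT fun n => (hp n).1.le
  have hfield := hω.indepField hT
  obtain ⟨d, hd⟩ := DynPerc.exists_card_ch_eq hT
  have hperc : ∀ x, DynPerc.percolationTimes T ω ρ x =
      {t : ℝ | hT.branchingTree.Survives (fun y => U y t x) ρ} := by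
    intro x
    ext t
    exact DynPerc.cluster_root_infinite_iff hT fun e => ω t e x
  have hclosed := hU.ae_isClosed_survives
  have hpos : μ {x | hT.branchingTree.Survives (fun y => U y (0 : ℚ) x) ρ ∧
      ¬ DynPerc.IntAt (fun t => hT.branchingTree.Survives (fun y => U y t x) ρ) 0} ≠ 0 := by
    refine (hQ.trans_le (measure_mono_ae ?_)).ne'
    filter_upwards [hclosed] with x hx hfr
    change (0 : ℝ) ∈ frontier (DynPerc.percolationTimes T ω ρ x) at hfr
    rw [hperc, (hx ρ).frontier_eq] at hfr
    refine ⟨by simpa using hfr.1, fun hint => hfr.2 ?_⟩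
    simpa using DynPerc.mem_interior_of_intAt (hx ρ) hint
  have hnot := hU.ae_forall_not_intAt hfield hd (ρ := ρ) SimpleGraph.dist_self hb hp hpos
  have hint : ∀ᵐ x ∂μ, ∀ v,
      interior {t : ℝ | hT.branchingTree.Survives (fun y => U y t x) v} = ∅ := by
    filter_upwards [hnot] with x hx v
    exact DynPerc.interior_eq_empty_of_forall_not_intAt (hx v)
  constructor
  · filter_upwards [hclosed, hint] with x hx hxint
    rw [hperc, (hx ρ).frontier_eq, hxint, Set.sdiff_empty]
  · filter_upwards [hclosed, hint] with x hx hxint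
    have hdense : Dense (⋂ v, {t : ℝ | hT.branchingTree.Survives (fun y => U y t x) v}ᶜ) :=
      dense_iInter_of_isOpen (fun v => (hx v).isOpen_compl)
        fun v => interior_eq_empty_iff_dense_compl.1 (hxint v)
    refine hdense.mono fun t ht v => ?_
    by_contra hinf
    obtain ⟨u, hu⟩ := DynPerc.exists_survives_of_cluster_infinite hT (fun e => ω t e x) hinf
    exact Set.mem_iInter.1 ht u hu
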